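/- **Lemma 6.2.** Let $\alpha\in(0,2)$, $a_0>0$, $c_1\ge 1$, $c_2>0$, and let $\phi\in C^4(\mathbb R\setminus\{0\})$ be a real function with $\phi(-x)=\phi(x)$ such that (A1) for $0<|x|\le a_0$: $\ \frac{1}{c_1}|x|^{-1-\alpha}\le\phi(x)\le c_1|x|^{-1-\alpha}$ and $|\phi^{(j)}(x)|\le c_1|x|^{-1-j-\alpha}$ for $j=1,2,3,4$; moreover $\phi$ is non-increasing on $(0,a_0]$; (A2) $\int_{|x|\ge a_0}|x|^j|\phi^{(j)}(x)|\,dx\le c_2$ for $j=0,1,2,3,4$. Let $A(\zeta)=\int_{\mathbb R\setminus\{0\}}(1-\cos(\zeta x))\phi(x)\,dx$, $\zeta\in\mathbb R$, be the symbol of the Lévy operator $\mathcal Lf(x)=\mathrm{p.v.}\int_{\mathbb R}\phi(x-y)(f(x)-f(y))\,dy$. There is a constant $C'>0$ depending only on $\alpha,a_0,c_1,c_2$ such that $A(\zeta)\ge C'^{-1}|\zeta|^\alpha-C'/2$ for all $\zeta\in\mathbb R$; in particular $C'+A>0$ everywhere. For this $C'$, and more generally for every real $C'$ with $C'+A(\zeta)>0$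 for all $\zeta\in\mathbb R$, let $\sqrt{C'\mathrm{Id}+\mathcal L}$ be the Fourier multiplier operator with symbol $\sqrt{C'+A(\zeta)}$, on $\mathbb R$ or on $\mathbb T=\mathbb R/\mathbb Z$ (where $\zeta\in 2\pi\mathbb Z$), the frequency variable $\zeta$ being that of $e^{i\zeta x}$. Then for every $\epsilon>0$ there is a constant $C>0$, depending only on $\phi$ (with its parameters), $C'$ and $\epsilon$, such that, both on $\mathbb R$ and on $\mathbb T$, for all complex-valued $f\in L^2$ and $g\in C^{\frac{\alpha}{2}+\epsilon}$, the commutator $$[\sqrt{C'\mathrm{Id}+\mathcal L},\,g]f=\sqrt{C'\mathrm{Id}+\mathcal L}\,(gf)-g\,\sqrt{C'\mathrm{Id}+\mathcal L}\,f$$ is a well-defined distribution, belongs to $L^2$, and $$\big\|[\sqrt{C'\mathrm{Id}+\mathcal L},\,g]f\big\|_{L^2}\le C\,\|f\|_{L^2}\,\|g\|_{C^{\frac{\alpha}{2}+\epsilon}}.$$ Here the product of $g$ with the distribution $\sqrt{C'\mathrm{Id}+\mathcal L}\,f$ is defined by duality, $\langle g\sqrt{C'\mathrm{Id}+\mathcal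 L}\,f,\psi\rangle=\langle\sqrt{C'\mathrm{Id}+\mathcal L}\,f,g\psi\rangle$ for test functions $\psi$ (Schwartz functions on $\mathbb R$, smooth functions on $\mathbb T$), where $\langle\sqrt{C'\mathrm{Id}+\mathcal L}\,f,u\rangle$ is given on the Fourier side by the absolutely convergent integral (on $\mathbb T$, series) of $\sqrt{C'+A}\,\widehat f$ against the inverse Fourier transform of $u$. For $s>0$ and $k=\lfloor s\rfloor$, $C^s$ is the space of $C^k$ functions on the line, or $1$-periodic ones in the case of $\mathbb T$, with finite norm $\|g\|_{C^s}=\sum_{j\le k}\|g^{(j)}\|_{L^\infty}+\sup_{x\ne y}|g^{(k)}(x)-g^{(k)}(y)|\,|x-y|^{-(s-k)}$. -/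

import Mathlib

open MeasureTheory Set
open scoped FourierTransform SchwartzMap ENNReal NNReal ContDiff

namespace LevyCommutator

noncomputable section

/-- A symmetric influence kernel `φ`, four times continuously differentiable away from the origin,
with strong alignment in the short range (fields `lower` to `anti`) and possible misalignment in
the long range (fields `tail_integrable`, `tail_le`). -/
structure IsLevyKernel (α a₀ c₁ c₂ : ℝ) (φ : ℝ → ℝ) : Prop where
  even : ∀ x, φ (-x) = φ x
  smooth : ContDiffOn ℝ 4 φ {0}ᶜ
  lower : ∀ x, 0 < |x| → |x| ≤ a₀ → 1 / c₁ * (1 / |x| ^ (1 + α)) ≤ φ x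
  upper : ∀ x, 0 < |x| → |x| ≤ a₀ → φ x ≤ c₁ / |x| ^ (1 + α)
  deriv_le : ∀ j : ℕ, 1 ≤ j → j ≤ 4 → ∀ x, 0 < |x| → |x| ≤ a₀ →
    |iteratedDeriv j φ x| ≤ c₁ / |x| ^ (1 + (j : ℝ) + α)
  anti : AntitoneOn φ (Ioc 0 a₀)
  tail_integrable : ∀ j : ℕ, j ≤ 4 →
    IntegrableOn (fun x : ℝ => |x| ^ j * |iteratedDeriv j φ x|) {x | a₀ ≤ |x|}
  tail_le : ∀ j : ℕ, j ≤ 4 → ∫ x in {x : ℝ | a₀ ≤ |x|}, |x| ^ j * |iteratedDeriv j φ x| ≤ c₂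

/-- The symbol `A(ζ)` of the Lévy operator with kernel `φ` (Lévy-Khintchine formula), with respect
to the frequency variable of the characters `x ↦ exp (i ζ x)`. -/
def levySymbol (φ : ℝ → ℝ) (ζ : ℝ) : ℝ :=
  ∫ x in ({0}ᶜ : Set ℝ), (1 - Real.cos (ζ * x)) * φ x

/-- The symbol `√(C' + A(ζ))` of the multiplier operator `√(C' Id + 𝓛)`. -/
def sqrtSymbol (φ : ℝ → ℝ) (C' : ℝ) (ζ : ℝ) : ℝ := √(C' + levySymbol φ ζ)

/-- The norm of the Hölder space `C^s`, `s ≥ 0`, on the line, with values in `[0, ∞]`: with `k` the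
integer part of `s`, the sum of the sup norms of the derivatives of order at most `k` and of the
Hölder seminorm of exponent `s - k` of the derivative of order `k`. -/
def holderNorm (s : ℝ) (g : ℝ → ℂ) : ℝ≥0∞ :=
  (∑ j ∈ Finset.range (⌊s⌋₊ + 1), ⨆ x, ‖iteratedDeriv j g x‖ₑ) +
    eHolderNorm (s - ⌊s⌋₊).toNNReal (iteratedDeriv ⌊s⌋₊ g)

/-- Membership in the Hölder space `C^s` of the line. -/
def MemHolder (s : ℝ) (g : ℝ → ℂ) : Prop :=
  ContDiff ℝ (⌊s⌋₊ : ℕ) g ∧ holderNorm s g < ⊤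

/-! ### The line -/

open Classical in
/-- The (Plancherel) Fourier transform of a square-integrable function on the line, with Mathlib's
convention `f̂(ξ) = ∫ exp (-2πi x ξ) f(x) dx`. It is only used for square-integrable functions. -/
def l2Fourier (f : ℝ → ℂ) : ℝ → ℂ :=
  if h : MemLp f 2 volume then ((𝓕 (h.toLp f) : Lp ℂ 2 (volume : Measure ℝ)) : ℝ → ℂ) else 0

open Classical in
/-- The (Plancherel) inverse Fourier transform of a square-integrable function on the line. -/
def l2FourierInv (f : ℝ → ℂ) : ℝ → ℂ :=
  if h : MemLp f 2 volume then ((𝓕⁻ (h.toLp f) : Lp ℂ 2 (volume : Measure ℝ)) : ℝ → ℂ) else 0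

/-- For `M` the Fourier multiplier operator with symbol `m`, the function `M f` (`f` in `L²`) is the
tempered distribution with Fourier transform `m f̂`; so `⟨M f, u⟩` is the integral over the line of
`(m f̂) · (𝓕⁻¹ u)`, and this is its integrand. Mathlib's frequency `ξ` is `ζ = 2πξ` for `m`. -/
def multIntegrand (m : ℝ → ℝ) (f u : ℝ → ℂ) (ξ : ℝ) : ℂ :=
  (m (2 * Real.pi * ξ) : ℂ) * l2Fourier f ξ * l2FourierInv u ξ

/-- The (bilinear) duality pairing `⟨M f, u⟩` on the line. -/
def multPairing (m : ℝ → ℝ) (f u : ℝ → ℂ) : ℂ := ∫ ξ, multIntegrand m f u ξ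

/-- `h` represents the tempered distribution `[M, g] f = M (g f) - g (M f)` on the line, where
the product of `g` with the distribution `M f` is defined by duality, `⟨g (M f), ψ⟩ = ⟨M f, g ψ⟩`,
and both pairings converge absolutely. -/
def IsCommutator (m : ℝ → ℝ) (g f h : ℝ → ℂ) : Prop :=
  ∀ ψ : 𝓢(ℝ, ℂ),
    Integrable (multIntegrand m (fun x => g x * f x) ψ) ∧
    Integrable (multIntegrand m f (fun x => g x * ψ x)) ∧
    ∫ x, h x * ψ x =
      multPairing m (fun x => g x * f x) ψ - multPairing m f (fun x => g x * ψ x)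

/-! ### The circle `ℝ / ℤ`, with its measure of total mass one -/

/-- The summand of `⟨M f, u⟩` on the circle: the Fourier coefficients of `M f` are
`m(2πn) f̂(n)`, and the pairing of two distributions on the circle is `∑ T̂(n) û(-n)`. -/
def multSummand (m : ℝ → ℝ) (f u : UnitAddCircle → ℂ) (n : ℤ) : ℂ :=
  (m (2 * Real.pi * n) : ℂ) * fourierCoeff f n * fourierCoeff u (-n)

/-- The (bilinear) duality pairing `⟨M f, u⟩` on the circle. -/
def multPairingCircle (m : ℝ → ℝ) (f u : UnitAddCircle → ℂ) : ℂ := ∑' n, multSummand m f u n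

/-- `h` represents the distribution `[M, g] f = M (g f) - g (M f)` on the circle, where
the product of `g` with the distribution `M f` is defined by duality, `⟨g (M f), ψ⟩ = ⟨M f, g ψ⟩`,
and both pairings converge absolutely. The test functions are the smooth functions. -/
def IsCommutatorCircle (m : ℝ → ℝ) (g f h : UnitAddCircle → ℂ) : Prop :=
  ∀ ψ : UnitAddCircle → ℂ, ContDiff ℝ ∞ (fun x : ℝ => ψ x) →
    Summable (multSummand m (fun x => g x * f x) ψ) ∧
    Summable (multSummand m f (fun x => g x * ψ x)) ∧
    ∫ x, h x * ψ x ∂AddCircle.haarAddCircle =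
      multPairingCircle m (fun x => g x * f x) ψ - multPairingCircle m f (fun x => g x * ψ x)

end

end LevyCommutator

/-!
Write `A = A_s + A_l`, where `A_s` is the symbol of the short jumps `|x| < a₀` and `A_l` that of the
long ones. By the integrability of the tail `A_l` is bounded, so `√(C' + A)` and `√A_s` differ by a
bounded function, whose multiplier operator has a bounded commutator with `g` for trivial reasons.
What remains is the commutator with `√L`, where `L` is the multiplier operator with symbol `A_s`.
Only the upper bound, the sign and the symmetry of the kernel `k` of `L` matter here; the lower
bound on `φ` is used for the coercivity of `A` alone (`IsLevyKernel.le_jumpSymbol_shortPart`: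
jumps of size comparable to `1 / |ζ|` suffice).

The square root is a superposition of resolvents, `c √L = ∫₀^∞ s^(1/2) (s⁻¹ - (s + L)⁻¹) ds`
(`integral_sqrt_mul`), and with `R = (s + L)⁻¹` and `G` the multiplication by `g`,
`[R, G] = -R [L, G] R`. Let `g` be Hölder continuous of exponent `σ`, with `α / 2 < σ < α` and `σ ≤ 1`, and let
`E z` be the translations, so that `L = ∫ k(z) (1 - E z) dz` and `‖[E z, G]‖ ≤ K |z| ^ σ`. Jumps
with `|z| > r` contribute `∫_{|z| > r} k(z) |z| ^ σ dz ≲ r ^ (σ - α)` to `[L, G]`. For `|z| ≤ r`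
this integral diverges, but pairing `z` with `-z` produces a second difference, hence a factor
`1 - E z` on one of the two arguments (`norm_inner_comm_add_comm_neg_le`); the Cauchy-Schwarz
inequality turns it into the Dirichlet form `∫ k(z) ‖b - E z b‖² dz = 2 ⟪b, L b⟫` and the
convergent moment `∫_{|z| ≤ r} k(z) |z| ^ (2 σ) dz ≲ r ^ (2 σ - α)`
(`IsJumpGenerator.norm_inner_comm_le`). With the energy bounds for `R` and `r = s ^ (-1/α)` one
gets `‖[R, G]‖ ≲ s ^ (-1 - σ/α)` (`IsJumpGenerator.norm_inner_resolvent_comm_le`), and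
`s ^ (1/2) ‖[R, G]‖` is integrable at infinity precisely because `σ > α / 2`; for `s ≤ 1` the trivial bound
`‖R‖ ≤ 1 / s` is enough.

All this takes place on `L²` of the frequency space (`ℝ` or `ℤ`), where translations are
multiplications by characters, so that the line and the circle are treated at once. It is carried
out for integrable kernels, for which `L` is bounded, with constants that do not depend on `∫ k`.
The singular kernel is then reached by removing the jumps smaller than `1 / (n + 1)`: elements
that are Hölder continuous of exponent `σ` along the translations are in the form domain of `L`
(`memLp_sqrt_jumpSymbol_mul`), which gives the absolute convergence of the pairings and allows
dominated convergence (`norm_integral_commDensity_le`). Test functions are such elements, and so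
are their products with `g`. The commutator, bounded as a form on them, is represented by an
element of `L²` (`exists_commutator`).
-/

namespace LevyCommutator

noncomputable section

local notation "⟪" x ", " y "⟫" => inner ℂ x y

/-! ### Unitary groups and jump generators -/

section Abstract

open ContinuousLinearMap

variable {H : Type*} [NormedAddCommGroup H] [InnerProductSpace ℂ H]

theorem inner_apply_neg {E : ℝ → H →ₗᵢ[ℂ] H} (hE : ∀ z x, E z (E (-z) x) = x) (z : ℝ) (x y : H) :
    ⟪x, E (-z) y⟫ = ⟪E z x, y⟫ := by
  rw [← (E z).inner_map_map x, hE]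

theorem norm_sub_apply_neg {E : ℝ → H →ₗᵢ[ℂ] H} (hE : ∀ z x, E z (E (-z) x) = x) (z : ℝ) (x : H) :
    ‖x - E (-z) x‖ = ‖x - E z x‖ := by
  rw [← (E z).norm_map, map_sub, hE, norm_sub_rev]

/-- The second difference in `z` of the commutators with a unitary group: besides the commutator
with `E z` it contains a difference `1 - E z` acting on one of the two arguments. -/
theorem norm_inner_comm_add_comm_neg_le {E : ℝ → H →ₗᵢ[ℂ] H} (hE : ∀ z x, E z (E (-z) x) = x)
    {G : H →L[ℂ] H} {κ : ℝ} (z : ℝ) (hG : ∀ x, ‖E z (G x) - G (E z x)‖ ≤ κ * ‖x‖) (a b : H) :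
    ‖⟪a, E z (G b) - G (E z b)⟫ + ⟪a, E (-z) (G b) - G (E (-z) b)⟫‖ ≤
      κ * (‖a‖ * ‖b - E z b‖ + ‖a - E z a‖ * ‖b‖) := by
  set y := E (-z) b with hy
  have hb : b = E z y := (hE z b).symm
  have key : ⟪a, E z (G b) - G (E z b)⟫ + ⟪a, E (-z) (G b) - G (E (-z) b)⟫ =
      ⟪a, E z (G (b - y)) - G (E z (b - y))⟫ + ⟪a - E z a, E z (G y) - G (E z y)⟫ := by
    have h1 : ⟪a, E (-z) (G b) - G y⟫ = ⟪E z a, G b - E z (G y)⟫ := by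
      rw [inner_sub_right, inner_apply_neg hE, inner_sub_right, (E z).inner_map_map]
    rw [h1]
    simp only [map_sub, inner_sub_left, inner_sub_right, ← hb]
    ring
  rw [key]
  have hyb : ‖b - y‖ = ‖b - E z b‖ := norm_sub_apply_neg hE z b
  have hyn : ‖y‖ = ‖b‖ := (E (-z)).norm_map b
  calc _ ≤ ‖a‖ * ‖E z (G (b - y)) - G (E z (b - y))‖ + ‖a - E z a‖ * ‖E z (G y) - G (E z y)‖ :=
        (norm_add_le _ _).trans (add_le_add (norm_inner_le_norm _ _) (norm_inner_le_norm _ _))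
    _ ≤ ‖a‖ * (κ * ‖b - y‖) + ‖a - E z a‖ * (κ * ‖y‖) := by
        gcongr
        · exact hG _
        · exact hG _
    _ = _ := by rw [hyb, hyn]; ring

/-- Polarization for an isometry: the source of the Dirichlet form. -/
theorem re_inner_sub_apply (E : H →ₗᵢ[ℂ] H) (b : H) :
    (2 : ℝ) * (⟪b, b - E b⟫).re = ‖b - E b‖ ^ 2 := by
  have h := @norm_sub_sq ℂ H _ _ _ b (E b)
  rw [E.norm_map] at h
  rw [h, inner_sub_right, Complex.sub_re, inner_self_eq_norm_sq_to_K]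
  simp only [RCLike.re_eq_complex_re, Complex.coe_algebraMap, ← Complex.ofReal_pow,
    Complex.ofReal_re]
  ring

/-- `L` is the operator `b ↦ ∫ k(z) (b - E z b) dz`, in the weak sense, for an integrable even
kernel `k ≥ 0`. Of the group law of the isometries `E z` only `E z (E (-z) x) = x` is recorded. The
integrability of `k` makes `L` bounded; no estimate depends on the size of the integral. -/
structure IsJumpGenerator (k : ℝ → ℝ) (E : ℝ → H →ₗᵢ[ℂ] H) (L : H →L[ℂ] H) : Prop where
  integrable : Integrable k
  nonneg : ∀ z, 0 ≤ k z
  even : ∀ z, k (-z) = k z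
  apply_apply_neg : ∀ z x, E z (E (-z) x) = x
  integrable_inner : ∀ a b, Integrable fun z => (k z : ℂ) * ⟪a, E z b⟫
  inner_apply : ∀ a b, ⟪a, L b⟫ = ∫ z, (k z : ℂ) * ⟪a, b - E z b⟫

namespace IsJumpGenerator

variable {k : ℝ → ℝ} {E : ℝ → H →ₗᵢ[ℂ] H} {L : H →L[ℂ] H}

theorem integrable_inner_sub (h : IsJumpGenerator k E L) (a b : H) :
    Integrable fun z => (k z : ℂ) * ⟪a, b - E z b⟫ := by
  have := (h.integrable.ofReal (𝕜 := ℂ)).mul_const ⟪a, b⟫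
  refine (this.sub (h.integrable_inner a b)).congr (ae_of_all _ fun z => ?_)
  simp only [Pi.sub_apply, inner_sub_right, mul_sub]
  rfl

theorem integrable_norm_sq (h : IsJumpGenerator k E L) (b : H) :
    Integrable fun z => k z * ‖b - E z b‖ ^ 2 := by
  refine ((h.integrable_inner_sub b b).re.const_mul 2).congr (ae_of_all _ fun z => ?_)
  simp only [RCLike.re_eq_complex_re, Complex.re_ofReal_mul, ← re_inner_sub_apply]
  ring

/-- The Dirichlet form of a jump generator. -/
theorem integral_norm_sq (h : IsJumpGenerator k E L) (b : H) :
    ∫ z, k z * ‖b - E z b‖ ^ 2 = 2 * (⟪b, L b⟫).re := by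
  rw [h.inner_apply, ← RCLike.re_eq_complex_re, ← integral_re (h.integrable_inner_sub b b),
    ← integral_const_mul]
  congr 1 with z
  simp only [RCLike.re_eq_complex_re, Complex.re_ofReal_mul, ← re_inner_sub_apply]
  ring

variable [CompleteSpace H]

theorem integrable_inner_comm (h : IsJumpGenerator k E L) (G : H →L[ℂ] H) (a b : H) :
    Integrable fun z => (k z : ℂ) * ⟪a, E z (G b) - G (E z b)⟫ := by
  refine ((h.integrable_inner a (G b)).sub (h.integrable_inner (adjoint G a) b)).congr
    (ae_of_all _ fun z => ?_)
  simp only [Pi.sub_apply, inner_sub_right, mul_sub, adjoint_inner_left]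

theorem inner_comm_eq (h : IsJumpGenerator k E L) (G : H →L[ℂ] H) (a b : H) :
    ⟪a, L (G b)⟫ - ⟪a, G (L b)⟫ = -∫ z, (k z : ℂ) * ⟪a, E z (G b) - G (E z b)⟫ := by
  rw [← adjoint_inner_left G, h.inner_apply, h.inner_apply,
    ← integral_sub (h.integrable_inner_sub _ _) (h.integrable_inner_sub _ _), ← integral_neg]
  congr 1 with z
  simp only [inner_sub_right, adjoint_inner_left]
  ring

/-- The commutator of a jump generator with an operator `G` that is Hölder continuous of exponent
`σ` along the group. Jumps longer than `r` are estimated directly, with `J₂` the moment of order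
`σ` of the kernel. For the shorter ones the terms `z` and `-z` are paired: the difference `1 - E z`
which this produces costs a Dirichlet form and leaves the moment `J₁` of order `2σ`. -/
theorem norm_inner_comm_le (h : IsJumpGenerator k E L) {G : H →L[ℂ] H} {K σ r J₁ J₂ lam : ℝ}
    (hK : 0 ≤ K) (hlam : 0 < lam)
    (hG : ∀ z x, ‖E z (G x) - G (E z x)‖ ≤ K * |z| ^ σ * ‖x‖)
    (hi₁ : IntegrableOn (fun z => k z * |z| ^ (2 * σ)) {z | |z| ≤ r})
    (hJ₁ : ∫ z in {z | |z| ≤ r}, k z * |z| ^ (2 * σ) ≤ J₁)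
    (hi₂ : IntegrableOn (fun z => k z * |z| ^ σ) {z | |z| ≤ r}ᶜ)
    (hJ₂ : ∫ z in {z | |z| ≤ r}ᶜ, k z * |z| ^ σ ≤ J₂) (a b : H) :
    ‖⟪a, L (G b)⟫ - ⟪a, G (L b)⟫‖ ≤
      K * ((lam * J₁ / 4 + J₂ / 2) * (‖a‖ ^ 2 + ‖b‖ ^ 2) +
        ((⟪a, L a⟫).re + (⟪b, L b⟫).re) / (2 * lam)) := by
  set Q : ℝ → ℂ := fun z => ⟪a, E z (G b) - G (E z b)⟫ with hQ
  have hms : MeasurableSet {z : ℝ | |z| ≤ r} := measurableSet_le (by fun_prop) (by fun_prop)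
  have hint := h.integrable_inner_comm G a b
  -- as `k` is even, `Q` may be replaced by its even part
  have hsymm : ∫ z, (k z : ℂ) * Q z = (1 / 2 : ℂ) * ∫ z, (k z : ℂ) * (Q z + Q (-z)) := by
    have h1 : ∫ z, (k z : ℂ) * Q (-z) = ∫ z, (k z : ℂ) * Q z := by
      rw [← integral_neg_eq_self (fun z => (k z : ℂ) * Q z)]
      simp only [h.even]
    have h2 : Integrable fun z => (k z : ℂ) * Q (-z) := by
      refine hint.comp_neg.congr (ae_of_all _ fun z => ?_)
      simp only [h.even, hQ]
    simp only [mul_add]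
    rw [integral_add hint h2, h1]
    ring
  set S := ‖a‖ ^ 2 + ‖b‖ ^ 2
  set Ψ : ℝ → ℝ := fun z =>
    K * (lam / 2 * S) * ({z | |z| ≤ r}.indicator (fun z => k z * |z| ^ (2 * σ)) z) +
    K / (2 * lam) * (k z * ‖a - E z a‖ ^ 2 + k z * ‖b - E z b‖ ^ 2) +
    K * S * ({z | |z| ≤ r}ᶜ.indicator (fun z => k z * |z| ^ σ) z) with hΨ
  have hΨint : Integrable Ψ := by
    refine Integrable.add (Integrable.add ?_ ?_) ?_
    · exact ((integrable_indicator_iff hms).2 hi₁).const_mul _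
    · exact ((h.integrable_norm_sq a).add (h.integrable_norm_sq b)).const_mul _
    · exact ((integrable_indicator_iff hms.compl).2 hi₂).const_mul _
  have hΨeq : ∫ z, Ψ z = K * (lam / 2 * S) * (∫ z in {z | |z| ≤ r}, k z * |z| ^ (2 * σ)) +
      K / (2 * lam) * (2 * (⟪a, L a⟫).re + 2 * (⟪b, L b⟫).re) +
      K * S * (∫ z in {z | |z| ≤ r}ᶜ, k z * |z| ^ σ) := by
    simp only [hΨ]
    rw [integral_add, integral_add, integral_const_mul, integral_const_mul, integral_const_mul,
      integral_add (h.integrable_norm_sq a) (h.integrable_norm_sq b), h.integral_norm_sq,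
      h.integral_norm_sq, integral_indicator hms, integral_indicator hms.compl]
    · exact ((integrable_indicator_iff hms).2 hi₁).const_mul _
    · exact ((h.integrable_norm_sq a).add (h.integrable_norm_sq b)).const_mul _
    · exact (((integrable_indicator_iff hms).2 hi₁).const_mul _).add
        (((h.integrable_norm_sq a).add (h.integrable_norm_sq b)).const_mul _)
    · exact ((integrable_indicator_iff hms.compl).2 hi₂).const_mul _
  have hbound : ∀ z, ‖(k z : ℂ) * (Q z + Q (-z))‖ ≤ Ψ z := by
    intro z
    have hkz := h.nonneg z
    have hzσ : 0 ≤ |z| ^ σ := by positivity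
    rw [norm_mul, Complex.norm_real, Real.norm_of_nonneg hkz]
    by_cases hz : |z| ≤ r
    · have h1 := norm_inner_comm_add_comm_neg_le h.apply_apply_neg z (hG z) a b
      have hsq : |z| ^ (2 * σ) = (|z| ^ σ) ^ 2 := by
        rw [mul_comm, Real.rpow_mul (abs_nonneg z), Real.rpow_two]
      have e1 : Ψ z = k z * (K * (lam / 2 * S * (|z| ^ σ) ^ 2 +
          (‖a - E z a‖ ^ 2 + ‖b - E z b‖ ^ 2) / (2 * lam))) := by
        simp only [hΨ]
        rw [indicator_of_mem (by exact hz), indicator_of_notMem (by simpa using hz), hsq]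
        ring
      rw [e1]
      refine mul_le_mul_of_nonneg_left (h1.trans ?_) hkz
      rw [mul_assoc]
      refine mul_le_mul_of_nonneg_left ?_ hK
      -- `2 x y ≤ lam x² + y² / lam` with `x = |z| ^ σ ‖a‖`, `y = ‖b - E z b‖`, and vice versa
      have amgm : ∀ x y : ℝ, x * y ≤ lam / 2 * x ^ 2 + y ^ 2 / (2 * lam) := by
        intro x y
        have : lam / 2 * x ^ 2 + y ^ 2 / (2 * lam) - x * y = (lam * x - y) ^ 2 / (2 * lam) := by
          field_simp; ring
        have h2 : 0 ≤ (lam * x - y) ^ 2 / (2 * lam) := by positivity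
        linarith
      have h2 := amgm (|z| ^ σ * ‖a‖) ‖b - E z b‖
      have h3 := amgm (|z| ^ σ * ‖b‖) ‖a - E z a‖
      calc _ = |z| ^ σ * ‖a‖ * ‖b - E z b‖ + |z| ^ σ * ‖b‖ * ‖a - E z a‖ := by ring
        _ ≤ _ := add_le_add h2 h3
        _ = _ := by simp only [S]; ring
    · have e1 : Ψ z = k z * (K * (S * |z| ^ σ +
          (‖a - E z a‖ ^ 2 + ‖b - E z b‖ ^ 2) / (2 * lam))) := by
        simp only [hΨ]
        rw [indicator_of_notMem (by exact hz), indicator_of_mem (by simpa using hz)]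
        ring
      rw [e1]
      refine mul_le_mul_of_nonneg_left ?_ hkz
      have hq : ∀ z, ‖Q z‖ ≤ K * |z| ^ σ * (‖a‖ * ‖b‖) := fun z =>
        (norm_inner_le_norm _ _).trans
          ((mul_le_mul_of_nonneg_left (hG z b) (norm_nonneg a)).trans_eq (by ring))
      have hq2 := hq (-z)
      rw [abs_neg] at hq2
      calc _ ≤ ‖Q z‖ + ‖Q (-z)‖ := norm_add_le _ _
        _ ≤ K * (2 * ‖a‖ * ‖b‖ * |z| ^ σ) := by linarith [hq z]
        _ ≤ _ := by
          refine mul_le_mul_of_nonneg_left ?_ hK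
          have : 2 * ‖a‖ * ‖b‖ ≤ S := two_mul_le_add_sq _ _
          have h3 : 0 ≤ (‖a - E z a‖ ^ 2 + ‖b - E z b‖ ^ 2) / (2 * lam) := by positivity
          have := mul_le_mul_of_nonneg_right this hzσ
          linarith
  rw [h.inner_comm_eq, norm_neg, hsymm, norm_mul]
  have hnorm := norm_integral_le_of_norm_le hΨint (ae_of_all _ hbound)
  have hS : 0 ≤ S := by positivity
  calc _ ≤ 1 / 2 * ∫ z, Ψ z := by
        rw [show ‖(1 / 2 : ℂ)‖ = 1 / 2 by norm_num]; gcongr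
    _ ≤ 1 / 2 * (K * (lam / 2 * S) * J₁ +
      K / (2 * lam) * (2 * (⟪a, L a⟫).re + 2 * (⟪b, L b⟫).re) + K * S * J₂) := by
        rw [hΨeq]; gcongr
    _ = _ := by field_simp; ring

end IsJumpGenerator
end Abstract

/-! ### Moments of a kernel bounded by a power -/

section Powers

theorem integrable_comp_abs {f : ℝ → ℝ} (hf : IntegrableOn f (Ioi 0)) :
    Integrable fun x => f |x| := by
  have h1 : IntegrableOn (fun x => f |x|) (Ioi 0) :=
    hf.congr_fun (fun x hx => by rw [abs_of_pos (by exact hx)]) measurableSet_Ioi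
  have h2 : IntegrableOn (fun x => f |x|) (Iic 0) := by
    rw [← Measure.map_neg_eq_self (volume : Measure ℝ)]
    let m : MeasurableEmbedding fun x : ℝ => -x := (Homeomorph.neg ℝ).measurableEmbedding
    rw [m.integrableOn_map_iff]
    simp_rw [Function.comp_def, abs_neg, neg_preimage, neg_Iic, neg_zero]
    exact Iff.mpr integrableOn_Ici_iff_integrableOn_Ioi h1
  rw [← integrableOn_univ, ← Iic_union_Ioi (a := (0 : ℝ))]
  exact h2.union h1

variable {k : ℝ → ℝ} {c α γ r : ℝ}

theorem integrableOn_abs_le_of_le_rpow (hm : AEStronglyMeasurable k)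
    (hk₀ : ∀ z, 0 ≤ k z) (hk : ∀ z, z ≠ 0 → k z ≤ c * |z| ^ (-1 - α)) (hγ₀ : 0 < γ) (hγ : α < γ)
    (hr : 0 ≤ r) :
    IntegrableOn (fun z => k z * |z| ^ γ) {z | |z| ≤ r} ∧
      ∫ z in {z | |z| ≤ r}, k z * |z| ^ γ ≤ 2 * c / (γ - α) * r ^ (γ - α) := by
  have hms : MeasurableSet {z : ℝ | |z| ≤ r} := measurableSet_le (by fun_prop) (by fun_prop)
  set f : ℝ → ℝ := (Ioc 0 r).indicator fun x => c * x ^ (γ - α - 1) with hf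
  have hfi : IntegrableOn f (Ioi 0) := by
    have : IntegrableOn (fun x : ℝ => c * x ^ (γ - α - 1)) (Ioc 0 r) := by
      rw [← intervalIntegrable_iff_integrableOn_Ioc_of_le hr]
      exact (intervalIntegral.intervalIntegrable_rpow' (by linarith)).const_mul c
    exact ((integrable_indicator_iff measurableSet_Ioc).2 this).integrableOn
  have hfv : ∫ x in Ioi (0 : ℝ), f x = c / (γ - α) * r ^ (γ - α) := by
    rw [hf, setIntegral_indicator measurableSet_Ioc, inter_eq_right.2 Ioc_subset_Ioi_self,
      integral_const_mul, ← intervalIntegral.integral_of_le hr, integral_rpow (by left; linarith)]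
    rw [sub_add_cancel, Real.zero_rpow (by linarith)]
    ring
  have hle : ∀ z, {z | |z| ≤ r}.indicator (fun z => k z * |z| ^ γ) z ≤ f |z| := by
    intro z
    by_cases hz : |z| ≤ r
    · rw [indicator_of_mem (by exact hz)]
      rcases eq_or_ne z 0 with rfl | h0
      · simp [hf, Real.zero_rpow hγ₀.ne']
      · have hz0 : 0 < |z| := abs_pos.2 h0
        rw [hf, indicator_of_mem (by exact ⟨hz0, hz⟩), show γ - α - 1 = (-1 - α) + γ by ring,
          Real.rpow_add hz0, ← mul_assoc]
        exact mul_le_mul_of_nonneg_right (hk z h0) (by positivity)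
    · rw [indicator_of_notMem (by exact hz), hf, indicator_of_notMem (fun h => hz h.2)]
  have hi : Integrable ({z | |z| ≤ r}.indicator fun z => k z * |z| ^ γ) := by
    refine (integrable_comp_abs hfi).mono' ?_ (ae_of_all _ fun z => ?_)
    · have hmp : Measurable fun z : ℝ => |z| ^ γ := by fun_prop
      exact (hm.mul hmp.aestronglyMeasurable).indicator hms
    · rw [Real.norm_of_nonneg]
      · exact hle z
      · exact indicator_nonneg (fun z _ => mul_nonneg (hk₀ z) (by positivity)) z
  refine ⟨(integrable_indicator_iff hms).1 hi, ?_⟩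
  rw [← integral_indicator hms]
  refine (integral_mono hi (integrable_comp_abs hfi) hle).trans_eq ?_
  rw [integral_comp_abs, hfv]
  ring

theorem integrableOn_lt_abs_of_le_rpow (hm : AEStronglyMeasurable k)
    (hk₀ : ∀ z, 0 ≤ k z) (hk : ∀ z, z ≠ 0 → k z ≤ c * |z| ^ (-1 - α)) (hγ : γ < α) (hr : 0 < r) :
    IntegrableOn (fun z => k z * |z| ^ γ) {z | |z| ≤ r}ᶜ ∧
      ∫ z in {z | |z| ≤ r}ᶜ, k z * |z| ^ γ ≤ 2 * c / (α - γ) * r ^ (γ - α) := by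
  have hms : MeasurableSet {z : ℝ | |z| ≤ r} := measurableSet_le (by fun_prop) (by fun_prop)
  set f : ℝ → ℝ := (Ioi r).indicator fun x => c * x ^ (γ - α - 1) with hf
  have hfi : IntegrableOn f (Ioi 0) :=
    ((integrable_indicator_iff measurableSet_Ioi).2
      ((integrableOn_Ioi_rpow_of_lt (by linarith) hr).const_mul c)).integrableOn
  have hfv : ∫ x in Ioi (0 : ℝ), f x = c / (α - γ) * r ^ (γ - α) := by
    rw [hf, setIntegral_indicator measurableSet_Ioi, inter_eq_right.2 (Ioi_subset_Ioi hr.le),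
      integral_const_mul, integral_Ioi_rpow_of_lt (by linarith) hr, sub_add_cancel,
      ← neg_sub α γ, div_neg]
    ring
  have hle : ∀ z, {z | |z| ≤ r}ᶜ.indicator (fun z => k z * |z| ^ γ) z ≤ f |z| := by
    intro z
    by_cases hz : |z| ≤ r
    · rw [indicator_of_notMem (by simpa using hz), hf, indicator_of_notMem (by simpa using hz)]
    · have hz0 : 0 < |z| := hr.trans (not_le.1 hz)
      rw [indicator_of_mem (by exact hz), hf, indicator_of_mem (by exact not_le.1 hz),
        show γ - α - 1 = (-1 - α) + γ by ring, Real.rpow_add hz0, ← mul_assoc]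
      exact mul_le_mul_of_nonneg_right (hk z (abs_pos.1 hz0)) (by positivity)
  have hi : Integrable ({z | |z| ≤ r}ᶜ.indicator fun z => k z * |z| ^ γ) := by
    refine (integrable_comp_abs hfi).mono' ?_ (ae_of_all _ fun z => ?_)
    · have hmp : Measurable fun z : ℝ => |z| ^ γ := by fun_prop
      exact (hm.mul hmp.aestronglyMeasurable).indicator hms.compl
    · rw [Real.norm_of_nonneg]
      · exact hle z
      · exact indicator_nonneg (fun z _ => mul_nonneg (hk₀ z) (by positivity)) z
  refine ⟨(integrable_indicator_iff hms.compl).1 hi, ?_⟩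
  rw [← integral_indicator hms.compl]
  refine (integral_mono hi (integrable_comp_abs hfi) hle).trans_eq ?_
  rw [integral_comp_abs, hfv]
  ring

end Powers

/-! ### Commutators with the resolvent -/

section Resolvent

variable {H : Type*} [NormedAddCommGroup H] [InnerProductSpace ℂ H]

/-- `R` is the resolvent `(s + L)⁻¹` of the symmetric operator `L`. -/
structure IsSymmResolvent (s : ℝ) (L R : H →L[ℂ] H) : Prop where
  symm : ∀ x y, ⟪L x, y⟫ = ⟪x, L y⟫
  resolvent_symm : ∀ x y, ⟪R x, y⟫ = ⟪x, R y⟫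
  apply_resolvent : ∀ x, L (R x) + (s : ℂ) • R x = x

variable {k : ℝ → ℝ} {E : ℝ → H →ₗᵢ[ℂ] H} {L R : H →L[ℂ] H} {s : ℝ}

namespace IsJumpGenerator

theorem re_inner_nonneg (h : IsJumpGenerator k E L) (b : H) : 0 ≤ (⟪b, L b⟫).re := by
  have h1 := h.integral_norm_sq b
  have h2 : 0 ≤ ∫ z, k z * ‖b - E z b‖ ^ 2 :=
    integral_nonneg fun z => mul_nonneg (h.nonneg z) (by positivity)
  linarith

/-- The energy estimate for the resolvent equation. -/
theorem resolvent_bounds (h : IsJumpGenerator k E L) (hR : IsSymmResolvent s L R) (hs : 0 < s)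
    (x : H) : ‖R x‖ ≤ ‖x‖ / s ∧ (⟪R x, L (R x)⟫).re ≤ ‖x‖ ^ 2 / s := by
  have h1 : (⟪R x, L (R x)⟫).re + s * ‖R x‖ ^ 2 = (⟪R x, x⟫).re := by
    conv_rhs => rw [← hR.apply_resolvent x, hR.apply_resolvent x]
    conv_rhs => arg 1; arg 3; rw [← hR.apply_resolvent x]
    rw [inner_add_right, inner_smul_right, Complex.add_re, Complex.re_ofReal_mul]
    congr 2
    exact (inner_self_eq_norm_sq (𝕜 := ℂ) (R x)).symm
  have h2 : (⟪R x, x⟫).re ≤ ‖R x‖ * ‖x‖ := re_inner_le_norm (𝕜 := ℂ) _ _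
  have h3 := h.re_inner_nonneg (R x)
  have h4 : ‖R x‖ ≤ ‖x‖ / s := by
    rw [le_div_iff₀ hs]
    rcases (norm_nonneg (R x)).eq_or_lt with h0 | h0
    · rw [← h0]; simp
    · refine le_of_mul_le_mul_left ?_ h0
      nlinarith
  refine ⟨h4, ?_⟩
  have h5 : ‖R x‖ * ‖x‖ ≤ ‖x‖ / s * ‖x‖ := mul_le_mul_of_nonneg_right h4 (norm_nonneg x)
  have h6 : 0 ≤ s * ‖R x‖ ^ 2 := by positivity
  calc _ ≤ ‖x‖ / s * ‖x‖ := by linarith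
    _ = _ := by ring

variable [CompleteSpace H]

/-- The commutator of the resolvent with a bounded operator that is Hölder continuous along the
group decays faster than `s ^ (-3/2)`. The scale at which the jumps are cut is `r = s ^ (-1/α)`. -/
theorem norm_inner_resolvent_comm_le (h : IsJumpGenerator k E L) (hR : IsSymmResolvent s L R)
    (hs : 0 < s) {G : H →L[ℂ] H} {K σ α c : ℝ} (hα : 0 < α) (hK : 0 ≤ K) (hc : 0 ≤ c)
    (hσα : σ < α) (hασ : α < 2 * σ) (hk : ∀ z, z ≠ 0 → k z ≤ c * |z| ^ (-1 - α))
    (hG : ∀ z x, ‖E z (G x) - G (E z x)‖ ≤ K * |z| ^ σ * ‖x‖) (u v : H) :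
    ‖⟪R v, G u⟫ - ⟪v, G (R u)⟫‖ ≤
      K * (c / (2 * (2 * σ - α)) + c / (α - σ) + 1 / 2) * (s ^ (-1 - σ / α)) *
        (‖u‖ ^ 2 + ‖v‖ ^ 2) := by
  set a := R v with ha
  set b := R u with hb
  -- `[R, G] = -R [L, G] R`
  have e1 : ⟪a, G u⟫ - ⟪v, G b⟫ = -(⟪a, L (G b)⟫ - ⟪a, G (L b)⟫) := by
    have hu := hR.apply_resolvent u
    have hv := hR.apply_resolvent v
    rw [← ha] at hv
    rw [← hb] at hu
    nth_rw 1 [← hu]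
    nth_rw 1 [← hv]
    rw [map_add, map_smul, inner_add_left, inner_add_right, inner_smul_left, inner_smul_right,
      hR.symm, Complex.conj_ofReal]
    ring
  set t := s ^ (-(σ / α)) with ht
  have htpos : 0 < t := Real.rpow_pos_of_pos hs _
  set r := s ^ (-(1 / α)) with hr
  have hrpos : 0 < r := Real.rpow_pos_of_pos hs _
  have hr1 : r ^ (2 * σ - α) = s * t ^ 2 := by
    rw [hr, ht, ← Real.rpow_mul hs.le, ← Real.rpow_two, ← Real.rpow_mul hs.le]
    nth_rw 2 [← Real.rpow_one s]
    rw [← Real.rpow_add hs]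
    congr 1
    field_simp
    ring
  have hr2 : r ^ (σ - α) = s * t := by
    rw [hr, ht, ← Real.rpow_mul hs.le]
    nth_rw 2 [← Real.rpow_one s]
    rw [← Real.rpow_add hs]
    congr 1
    field_simp
    ring
  have hts : s ^ (-1 - σ / α) = t / s := by
    rw [ht, sub_eq_add_neg, add_comm, Real.rpow_add hs, Real.rpow_neg_one]
    rfl
  obtain ⟨i1, J1⟩ := integrableOn_abs_le_of_le_rpow h.integrable.aestronglyMeasurable h.nonneg hk
    (by linarith : 0 < 2 * σ) hασ hrpos.le
  obtain ⟨i2, J2⟩ := integrableOn_lt_abs_of_le_rpow h.integrable.aestronglyMeasurable h.nonneg hk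
    hσα hrpos
  rw [hr1] at J1
  rw [hr2] at J2
  -- the weight `lam = 1 / t` balances the Dirichlet forms against the moments
  have key := h.norm_inner_comm_le hK (inv_pos.2 htpos) hG i1 J1 i2 J2 a b
  obtain ⟨na, qa⟩ := h.resolvent_bounds hR hs v
  obtain ⟨nb, qb⟩ := h.resolvent_bounds hR hs u
  rw [← ha] at na qa
  rw [← hb] at nb qb
  have hd1 : 0 < 2 * σ - α := by linarith
  have hd2 : 0 < α - σ := by linarith
  rw [e1, norm_neg]
  refine key.trans ?_
  have e2 : ‖a‖ ^ 2 + ‖b‖ ^ 2 ≤ (‖v‖ / s) ^ 2 + (‖u‖ / s) ^ 2 := by gcongr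
  calc _ ≤ K * ((t⁻¹ * (2 * c / (2 * σ - α) * (s * t ^ 2)) / 4 + 2 * c / (α - σ) * (s * t) / 2) *
        ((‖v‖ / s) ^ 2 + (‖u‖ / s) ^ 2) + (‖v‖ ^ 2 / s + ‖u‖ ^ 2 / s) / (2 * t⁻¹)) := by gcongr
    _ = _ := by rw [hts]; field_simp; ring

end IsJumpGenerator
end Resolvent

/-! ### Multiplication operators on `L²` -/

section Multiplication

variable {X : Type*} [MeasurableSpace X] {μ : Measure X}

theorem memLp_bdd_mul {h : X → ℂ} (hm : Measurable h) {C : ℝ} (hC : ∀ x, ‖h x‖ ≤ C)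
    {f : X → ℂ} (hf : MemLp f 2 μ) : MemLp (fun x => h x * f x) 2 μ :=
  hf.of_le_mul (c := C) (hm.aestronglyMeasurable.mul hf.aestronglyMeasurable)
    (ae_of_all _ fun x => by rw [norm_mul]; exact mul_le_mul_of_nonneg_right (hC x) (norm_nonneg _))

/-- The operator of multiplication by a bounded measurable function on `L²`. -/
def mulLp (μ : Measure X) {h : X → ℂ} (hm : Measurable h) {C : ℝ} (hC : ∀ x, ‖h x‖ ≤ C) :
    Lp ℂ 2 μ →L[ℂ] Lp ℂ 2 μ :=
  LinearMap.mkContinuous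
    { toFun := fun f => (memLp_bdd_mul hm hC (Lp.memLp f)).toLp _
      map_add' := fun f g => by
        ext1
        filter_upwards [MemLp.coeFn_toLp (memLp_bdd_mul hm hC (Lp.memLp (f + g))),
          MemLp.coeFn_toLp (memLp_bdd_mul hm hC (Lp.memLp f)),
          MemLp.coeFn_toLp (memLp_bdd_mul hm hC (Lp.memLp g)), Lp.coeFn_add f g,
          Lp.coeFn_add ((memLp_bdd_mul hm hC (Lp.memLp f)).toLp _)
            ((memLp_bdd_mul hm hC (Lp.memLp g)).toLp _)] with x h1 h2 h3 h4 h5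
        rw [h1, h5, Pi.add_apply, h2, h3, h4, Pi.add_apply, mul_add]
      map_smul' := fun c f => by
        ext1
        filter_upwards [MemLp.coeFn_toLp (memLp_bdd_mul hm hC (Lp.memLp (c • f))),
          MemLp.coeFn_toLp (memLp_bdd_mul hm hC (Lp.memLp f)), Lp.coeFn_smul c f,
          Lp.coeFn_smul c ((memLp_bdd_mul hm hC (Lp.memLp f)).toLp _)] with x h1 h2 h3 h4
        rw [h1, RingHom.id_apply, h4, Pi.smul_apply, h2, h3, Pi.smul_apply, smul_eq_mul,
          smul_eq_mul]
        ring }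
    C fun f => by
      refine Lp.norm_le_mul_norm_of_ae_le_mul ?_
      filter_upwards [MemLp.coeFn_toLp (memLp_bdd_mul hm hC (Lp.memLp f))] with x hx
      change ‖((memLp_bdd_mul hm hC (Lp.memLp f)).toLp _) x‖ ≤ _
      rw [hx, norm_mul]
      exact mul_le_mul_of_nonneg_right (hC x) (norm_nonneg _)

variable {h : X → ℂ} (hm : Measurable h) {C : ℝ} (hC : ∀ x, ‖h x‖ ≤ C)

theorem coeFn_mulLp (f : Lp ℂ 2 μ) : mulLp μ hm hC f =ᵐ[μ] fun x => h x * f x :=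
  MemLp.coeFn_toLp (memLp_bdd_mul hm hC (Lp.memLp f))

theorem norm_mulLp_apply_le (f : Lp ℂ 2 μ) : ‖mulLp μ hm hC f‖ ≤ C * ‖f‖ := by
  refine Lp.norm_le_mul_norm_of_ae_le_mul ?_
  filter_upwards [coeFn_mulLp hm hC f] with x hx
  rw [hx, norm_mul]
  exact mul_le_mul_of_nonneg_right (hC x) (norm_nonneg _)

theorem mulLp_toLp {f : X → ℂ} (hf : MemLp f 2 μ) :
    mulLp μ hm hC (hf.toLp _) = (memLp_bdd_mul hm hC hf).toLp _ := by
  ext1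
  filter_upwards [coeFn_mulLp hm hC (hf.toLp _), hf.coeFn_toLp,
    (memLp_bdd_mul hm hC hf).coeFn_toLp] with x h1 h2 h3
  rw [h1, h2, h3]

theorem inner_eq_integral (a b : Lp ℂ 2 μ) : ⟪a, b⟫ = ∫ x, starRingEnd ℂ (a x) * b x ∂μ := by
  rw [L2.inner_def]
  congr 1 with x
  rw [RCLike.inner_apply, mul_comm]

theorem integrable_conj_mul (a b : Lp ℂ 2 μ) :
    Integrable (fun x => starRingEnd ℂ (a x) * b x) μ := by
  refine (L2.integrable_inner (𝕜 := ℂ) a b).congr (ae_of_all _ fun x => ?_)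
  simp only [RCLike.inner_apply]
  ring

theorem inner_mulLp_right (a b : Lp ℂ 2 μ) :
    ⟪a, mulLp μ hm hC b⟫ = ∫ x, h x * (starRingEnd ℂ (a x) * b x) ∂μ := by
  rw [inner_eq_integral]
  refine integral_congr_ae ?_
  filter_upwards [coeFn_mulLp hm hC b] with x hx
  rw [hx]; ring

theorem inner_mulLp_left (hreal : ∀ x, starRingEnd ℂ (h x) = h x) (a b : Lp ℂ 2 μ) :
    ⟪mulLp μ hm hC a, b⟫ = ∫ x, h x * (starRingEnd ℂ (a x) * b x) ∂μ := by
  rw [inner_eq_integral]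
  refine integral_congr_ae ?_
  filter_upwards [coeFn_mulLp hm hC a] with x hx
  rw [hx, map_mul, hreal]; ring

theorem adjoint_mulLp {h' : X → ℂ} (hm' : Measurable h') {C' : ℝ} (hC' : ∀ x, ‖h' x‖ ≤ C')
    (hh : ∀ x, h' x = starRingEnd ℂ (h x)) :
    ContinuousLinearMap.adjoint (mulLp μ hm hC) = mulLp μ hm' hC' := by
  refine ((ContinuousLinearMap.eq_adjoint_iff _ _).2 fun a b => ?_).symm
  rw [inner_mulLp_right, inner_eq_integral]
  refine integral_congr_ae ?_
  filter_upwards [coeFn_mulLp hm' hC' a] with x hx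
  rw [hx, map_mul, hh, Complex.conj_conj]; ring

end Multiplication

/-! ### Translations on the Fourier side -/

section Phase

variable {Ω : Type*} [MeasurableSpace Ω] {ν : Measure Ω} {p : Ω → ℝ}

theorem measurable_phase (hp : Measurable p) (z : ℝ) :
    Measurable fun ξ => Complex.exp ((p ξ * z : ℝ) * Complex.I) := by fun_prop

/-- Multiplication by the character `exp (i p z)` on `L²`: translation by `z`, seen on the Fourier
side. -/
def phase (ν : Measure Ω) (hp : Measurable p) (z : ℝ) : Lp ℂ 2 ν →ₗᵢ[ℂ] Lp ℂ 2 ν where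
  toLinearMap := (mulLp ν (measurable_phase hp z) (C := 1)
    fun _ => (Complex.norm_exp_ofReal_mul_I _).le).toLinearMap
  norm_map' f := by
    refine le_antisymm ((norm_mulLp_apply_le _ _ f).trans_eq (one_mul _)) ?_
    rw [← one_mul ‖(mulLp ν (measurable_phase hp z) (C := 1) _).toLinearMap f‖]
    refine Lp.norm_le_mul_norm_of_ae_le_mul ?_
    filter_upwards [coeFn_mulLp (μ := ν) (measurable_phase hp z) (C := 1)
      (fun _ => (Complex.norm_exp_ofReal_mul_I _).le) f] with x hx
    rw [ContinuousLinearMap.coe_coe, hx, norm_mul, Complex.norm_exp_ofReal_mul_I, one_mul, one_mul]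

theorem coeFn_phase (hp : Measurable p) (z : ℝ) (f : Lp ℂ 2 ν) :
    phase ν hp z f =ᵐ[ν] fun ξ => Complex.exp ((p ξ * z : ℝ) * Complex.I) * f ξ :=
  coeFn_mulLp (measurable_phase hp z) (fun _ => (Complex.norm_exp_ofReal_mul_I _).le) f

theorem phase_apply_neg (hp : Measurable p) (z : ℝ) (f : Lp ℂ 2 ν) :
    phase ν hp z (phase ν hp (-z) f) = f := by
  ext1
  filter_upwards [coeFn_phase hp z (phase ν hp (-z) f), coeFn_phase hp (-z) f] with x h1 h2
  rw [h1, h2, ← mul_assoc, ← Complex.exp_add]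
  have : ((p x * z : ℝ) : ℂ) * Complex.I + ((p x * -z : ℝ) : ℂ) * Complex.I = 0 := by
    push_cast; ring
  rw [this, Complex.exp_zero, one_mul]

theorem inner_phase (hp : Measurable p) (z : ℝ) (a b : Lp ℂ 2 ν) :
    ⟪a, phase ν hp z b⟫ =
      ∫ ξ, Complex.exp ((p ξ * z : ℝ) * Complex.I) * (starRingEnd ℂ (a ξ) * b ξ) ∂ν :=
  inner_mulLp_right (measurable_phase hp z) (fun _ => (Complex.norm_exp_ofReal_mul_I _).le) a b

end Phase

/-! ### Symbols of jump kernels -/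

section Symbol

/-- The Lévy-Khintchine symbol `∫ (1 - cos (ζ z)) k(z) dz` of a jump kernel on the line. -/
def jumpSymbol (k : ℝ → ℝ) (ζ : ℝ) : ℝ := ∫ z, (1 - Real.cos (ζ * z)) * k z

theorem one_sub_cos_mem (x : ℝ) : 1 - Real.cos x ∈ Icc (0 : ℝ) 2 :=
  ⟨by linarith [Real.cos_le_one x], by linarith [Real.neg_one_le_cos x]⟩

variable {k : ℝ → ℝ}

theorem measurable_jumpSymbol (hk : Measurable k) : Measurable (jumpSymbol k) := by
  have : StronglyMeasurable
      (Function.uncurry fun ζ z : ℝ => (1 - Real.cos (ζ * z)) * k z) := by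
    apply Measurable.stronglyMeasurable
    simp only [Function.uncurry_def]
    fun_prop
  exact this.integral_prod_right.measurable

theorem jumpSymbol_nonneg (hk : ∀ z, 0 ≤ k z) (ζ : ℝ) : 0 ≤ jumpSymbol k ζ :=
  integral_nonneg fun z => mul_nonneg (one_sub_cos_mem _).1 (hk z)

theorem abs_jumpSymbol_le (hk : Integrable k) (ζ : ℝ) :
    |jumpSymbol k ζ| ≤ 2 * ∫ z, |k z| := by
  rw [← integral_const_mul, ← Real.norm_eq_abs]
  refine norm_integral_le_of_norm_le (hk.abs.const_mul 2) (ae_of_all _ fun z => ?_)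
  rw [norm_mul, Real.norm_of_nonneg (one_sub_cos_mem _).1, Real.norm_eq_abs]
  exact mul_le_mul_of_nonneg_right (one_sub_cos_mem _).2 (abs_nonneg _)

/-- The kernel being even, the imaginary part `∫ sin (ζ z) k(z) dz` vanishes. -/
theorem integral_one_sub_exp_mul (hk : Integrable k) (heven : ∀ z, k (-z) = k z) (ζ : ℝ) :
    ∫ z, (k z : ℂ) * (1 - Complex.exp ((ζ * z : ℝ) * Complex.I)) = (jumpSymbol k ζ : ℂ) := by
  set F : ℝ → ℂ := fun z => (k z : ℂ) * (1 - Complex.exp ((ζ * z : ℝ) * Complex.I)) with hF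
  have hFi : Integrable F := by
    refine (hk.ofReal (𝕜 := ℂ)).mul_bdd (c := 2) (by fun_prop) (ae_of_all _ fun z => ?_)
    refine (norm_sub_le _ _).trans ?_
    rw [Complex.norm_exp_ofReal_mul_I, norm_one]
    norm_num
  have h1 : ∫ z, F z = ∫ z, F (-z) := (integral_neg_eq_self F volume).symm
  have h2 : 2 * ∫ z, F z = ∫ z, (F z + F (-z)) := by
    rw [integral_add hFi hFi.comp_neg, ← h1, two_mul]
  have h3 : ∀ z, F z + F (-z) = 2 * (((1 - Real.cos (ζ * z)) * k z : ℝ) : ℂ) := by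
    intro z
    simp only [hF, heven]
    push_cast
    rw [Complex.cos]
    have : ((ζ : ℂ) * -z) * Complex.I = -(ζ * z) * Complex.I := by ring
    rw [this]
    ring
  simp only [h3, integral_const_mul] at h2
  rw [jumpSymbol, ← integral_complex_ofReal]
  exact mul_left_cancel₀ two_ne_zero h2

end Symbol

/-! ### Jump generators as multiplication operators -/

section Generator

variable {Ω : Type*} [MeasurableSpace Ω] {ν : Measure Ω} {p : Ω → ℝ} {k : ℝ → ℝ}

/-- The operator of multiplication by a bounded real measurable function on `L²`. -/
abbrev realMulLp (ν : Measure Ω) {h : Ω → ℝ} (hm : Measurable h) {C : ℝ}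
    (hC : ∀ ξ, |h ξ| ≤ C) : Lp ℂ 2 ν →L[ℂ] Lp ℂ 2 ν :=
  mulLp ν (h := fun ξ => (h ξ : ℂ)) (by fun_prop) (C := C)
    (fun ξ => by rw [Complex.norm_real]; exact hC ξ)

/-- On the Fourier side, multiplication by the symbol is the jump generator of the translations. -/
theorem isJumpGenerator_mulLp [SFinite ν] (hp : Measurable p) (hk : Integrable k)
    (hk₀ : ∀ z, 0 ≤ k z)
    (heven : ∀ z, k (-z) = k z) (hkm : Measurable fun ξ => jumpSymbol k (p ξ)) {C : ℝ}
    (hC : ∀ ξ, |jumpSymbol k (p ξ)| ≤ C) :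
    IsJumpGenerator k (phase ν hp) (realMulLp ν hkm hC) := by
  have hF : ∀ a b : Lp ℂ 2 ν, Integrable (fun q : Ω × ℝ => (k q.2 : ℂ) *
      Complex.exp ((p q.1 * q.2 : ℝ) * Complex.I) * (starRingEnd ℂ (a q.1) * b q.1))
      (ν.prod volume) := by
    intro a b
    have h1 : Integrable (fun q : Ω × ℝ => (starRingEnd ℂ (a q.1) * b q.1) * (k q.2 : ℂ))
      (ν.prod volume) := (integrable_conj_mul a b).mul_prod (hk.ofReal (𝕜 := ℂ))
    refine (h1.bdd_mul (c := 1) (f := fun q : Ω × ℝ =>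
      Complex.exp ((p q.1 * q.2 : ℝ) * Complex.I)) ?_ (ae_of_all _ fun q => ?_)).congr
      (ae_of_all _ fun q => ?_)
    · exact Measurable.aestronglyMeasurable (by fun_prop)
    · exact (Complex.norm_exp_ofReal_mul_I _).le
    · simp only; ring
  have hG : ∀ a b : Lp ℂ 2 ν, Integrable (fun q : Ω × ℝ =>
      (starRingEnd ℂ (a q.1) * b q.1) * (k q.2 : ℂ)) (ν.prod volume) := fun a b =>
    (integrable_conj_mul a b).mul_prod (hk.ofReal (𝕜 := ℂ))
  refine ⟨hk, hk₀, heven, phase_apply_neg hp, fun a b => ?_, fun a b => ?_⟩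
  · refine (hF a b).integral_prod_right.congr (ae_of_all _ fun z => ?_)
    simp only [inner_phase, ← integral_const_mul, mul_assoc]
  · rw [inner_mulLp_right]
    have h1 : ∀ z, (k z : ℂ) * ⟪a, b - phase ν hp z b⟫ =
        ∫ ξ, ((starRingEnd ℂ (a ξ) * b ξ) * (k z : ℂ) - (k z : ℂ) *
      Complex.exp ((p ξ * z : ℝ) * Complex.I) * (starRingEnd ℂ (a ξ) * b ξ)) ∂ν := by
      intro z
      have h2 : ∫ ξ, (k z : ℂ) * Complex.exp ((p ξ * z : ℝ) * Complex.I) *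
          (starRingEnd ℂ (a ξ) * b ξ) ∂ν = (k z : ℂ) *
          ∫ ξ, Complex.exp ((p ξ * z : ℝ) * Complex.I) * (starRingEnd ℂ (a ξ) * b ξ) ∂ν := by
        rw [← integral_const_mul]
        simp only [mul_assoc]
      rw [inner_sub_right, inner_phase, inner_eq_integral, integral_sub, integral_mul_const,
        mul_sub, h2, mul_comm (k z : ℂ) (∫ ξ, starRingEnd ℂ (a ξ) * b ξ ∂ν)]
      · exact (integrable_conj_mul a b).mul_const _
      · simp only [mul_assoc]
        refine Integrable.const_mul ?_ _
        refine (integrable_conj_mul a b).bdd_mul (c := 1) ?_ (ae_of_all _ fun ξ => ?_)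
        · exact Measurable.aestronglyMeasurable (by fun_prop)
        · exact (Complex.norm_exp_ofReal_mul_I _).le
    simp only [h1]
    rw [← integral_integral_swap (f := fun (ξ : Ω) (z : ℝ) =>
      (starRingEnd ℂ (a ξ) * b ξ) * (k z : ℂ) - (k z : ℂ) *
      Complex.exp ((p ξ * z : ℝ) * Complex.I) * (starRingEnd ℂ (a ξ) * b ξ))
      ((hG a b).sub (hF a b))]
    congr 1 with ξ
    rw [← integral_one_sub_exp_mul hk heven, ← integral_mul_const]
    congr 1 with z
    ring

theorem isSymmResolvent_mulLp {A : Ω → ℝ} (hA : Measurable A) (hA₀ : ∀ ξ, 0 ≤ A ξ) {C : ℝ}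
    (hC : ∀ ξ, |A ξ| ≤ C) {s : ℝ} (hs : 0 < s) (hR : Measurable fun ξ => (s + A ξ)⁻¹) {D : ℝ}
    (hD : ∀ ξ, |(s + A ξ)⁻¹| ≤ D) :
    IsSymmResolvent s (realMulLp ν hA hC) (realMulLp ν hR hD) := by
  refine ⟨fun x y => ?_, fun x y => ?_, fun x => ?_⟩
  · rw [inner_mulLp_right, inner_mulLp_left]
    simp
  · rw [inner_mulLp_right, inner_mulLp_left]
    simp [-Complex.ofReal_inv]
  · ext1
    filter_upwards [Lp.coeFn_add (realMulLp ν hA hC (realMulLp ν hR hD x))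
      ((s : ℂ) • realMulLp ν hR hD x), Lp.coeFn_smul (s : ℂ) (realMulLp ν hR hD x),
      coeFn_mulLp (μ := ν) (h := fun ξ => (A ξ : ℂ)) (by fun_prop) (C := C)
        (fun ξ => by rw [Complex.norm_real]; exact hC ξ) (realMulLp ν hR hD x),
      coeFn_mulLp (μ := ν) (h := fun ξ => (((s + A ξ)⁻¹ : ℝ) : ℂ)) (by fun_prop) (C := D)
        (fun ξ => by rw [Complex.norm_real]; exact hD ξ) x] with ξ h1 h2 h3 h4
    rw [h1, Pi.add_apply, h2, Pi.smul_apply, h3, h4, smul_eq_mul]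
    have h5 : s + A ξ ≠ 0 := (by linarith [hA₀ ξ] : 0 < s + A ξ).ne'
    have h6 : (A ξ : ℂ) * ((s + A ξ)⁻¹ : ℝ) + (s : ℂ) * ((s + A ξ)⁻¹ : ℝ) = 1 := by
      rw [← Complex.ofReal_mul, ← Complex.ofReal_mul, ← Complex.ofReal_add, ← add_mul, add_comm,
        mul_inv_cancel₀ h5, Complex.ofReal_one]
    linear_combination (x ξ) * h6

end Generator

/-! ### The square root as an integral of resolvents -/

section SqrtRepresentation

open Real (rpowIntegrand₀₁)

/-- The constant in the representation `c √x = ∫₀^∞ s^(1/2) (s⁻¹ - (s + x)⁻¹) ds`. -/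
def sqrtConst : ℝ := ∫ s in Ioi 0, rpowIntegrand₀₁ (1 / 2) s 1

theorem half_mem_Ioo : (1 / 2 : ℝ) ∈ Ioo 0 1 := by constructor <;> norm_num

theorem sqrtConst_pos : 0 < sqrtConst := Real.integral_rpowIntegrand₀₁_one_pos half_mem_Ioo

theorem integral_rpowIntegrand_half {x : ℝ} (hx : 0 ≤ x) :
    ∫ s in Ioi 0, rpowIntegrand₀₁ (1 / 2) s x = √x * sqrtConst := by
  rw [Real.integral_rpowIntegrand₀₁_eq_rpow_mul_const half_mem_Ioo hx, Real.sqrt_eq_rpow]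
  rfl

variable {Ω : Type*} [MeasurableSpace Ω] {ν : Measure Ω} [SFinite ν]

/-- `√A` as a superposition of the resolvents of `A`. Mathlib's `rpowIntegrand₀₁ (1 / 2) s x` is
`s ^ (1/2) * (s⁻¹ - (s + x)⁻¹)`. -/
theorem integral_sqrt_mul {w : Ω → ℂ} (hw : Integrable w ν) {A : Ω → ℝ} (hA : Measurable A)
    (hA₀ : ∀ ξ, 0 ≤ A ξ) {C : ℝ} (hC : ∀ ξ, |A ξ| ≤ C) :
    ∫ s in Ioi (0 : ℝ), ∫ ξ, (rpowIntegrand₀₁ (1 / 2) s (A ξ) : ℂ) * w ξ ∂ν =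
      sqrtConst * ∫ ξ, ((√(A ξ) : ℝ) : ℂ) * w ξ ∂ν := by
  have hsm : AEStronglyMeasurable (Function.uncurry fun (ξ : Ω) (s : ℝ) =>
      (rpowIntegrand₀₁ (1 / 2) s (A ξ) : ℂ) * w ξ) (ν.prod (volume.restrict (Ioi 0))) := by
    have hr : Measurable fun q : Ω × ℝ => (rpowIntegrand₀₁ (1 / 2) q.2 (A q.1) : ℂ) := by
      unfold Real.rpowIntegrand₀₁
      fun_prop
    exact hr.aestronglyMeasurable.mul hw.aestronglyMeasurable.comp_fst
  have hrep : ∀ ξ, ∫ s in Ioi (0 : ℝ), ‖(rpowIntegrand₀₁ (1 / 2) s (A ξ) : ℂ) * w ξ‖ =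
      √(A ξ) * sqrtConst * ‖w ξ‖ := by
    intro ξ
    rw [← integral_rpowIntegrand_half (hA₀ ξ), ← integral_mul_const]
    refine setIntegral_congr_fun measurableSet_Ioi fun s hs => ?_
    rw [norm_mul, Complex.norm_real, Real.norm_of_nonneg
      (Real.rpowIntegrand₀₁_nonneg half_mem_Ioo.1 (le_of_lt hs) (hA₀ ξ))]
  have hint : Integrable (Function.uncurry fun (ξ : Ω) (s : ℝ) =>
      (rpowIntegrand₀₁ (1 / 2) s (A ξ) : ℂ) * w ξ) (ν.prod (volume.restrict (Ioi 0))) := by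
    refine (integrable_prod_iff hsm).2 ⟨ae_of_all _ fun ξ => ?_, ?_⟩
    · exact Integrable.mul_const (f := fun s => (rpowIntegrand₀₁ (1 / 2) s (A ξ) : ℂ))
        ((Real.integrableOn_rpowIntegrand₀₁_Ioi half_mem_Ioo (hA₀ ξ)).ofReal (𝕜 := ℂ)) (w ξ)
    · simp only [Function.uncurry_apply_pair, hrep]
      refine hw.norm.bdd_mul (c := √C * sqrtConst) ?_ (ae_of_all _ fun ξ => ?_)
      · exact Measurable.aestronglyMeasurable (by fun_prop)
      · rw [norm_mul, Real.norm_of_nonneg (Real.sqrt_nonneg _),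
          Real.norm_of_nonneg sqrtConst_pos.le]
        exact mul_le_mul_of_nonneg_right (Real.sqrt_le_sqrt ((le_abs_self _).trans (hC ξ)))
          sqrtConst_pos.le
  rw [← integral_integral_swap hint, ← integral_const_mul]
  congr 1 with ξ
  rw [integral_mul_const, ← mul_assoc]
  congr 1
  rw [integral_complex_ofReal, integral_rpowIntegrand_half (hA₀ ξ)]
  push_cast
  ring

end SqrtRepresentation

section Homogeneity

variable {H : Type*} [NormedAddCommGroup H] [InnerProductSpace ℂ H]

/-- A quadratic bound on a sesquilinear form becomes bilinear on normalizing both arguments. -/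
theorem norm_inner_apply_le_of_sq {B : H →L[ℂ] H} {C : ℝ}
    (h : ∀ u v, ‖⟪v, B u⟫‖ ≤ C * (‖u‖ ^ 2 + ‖v‖ ^ 2)) (u v : H) :
    ‖⟪v, B u⟫‖ ≤ 2 * C * (‖u‖ * ‖v‖) := by
  rcases eq_or_ne u 0 with rfl | hu
  · simp
  rcases eq_or_ne v 0 with rfl | hv
  · simp
  have hu' : 0 < ‖u‖ := norm_pos_iff.2 hu
  have hv' : 0 < ‖v‖ := norm_pos_iff.2 hv
  have h1 := h (((‖u‖⁻¹ : ℝ) : ℂ) • u) (((‖v‖⁻¹ : ℝ) : ℂ) • v)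
  simp only [map_smul, inner_smul_left, inner_smul_right, norm_mul, norm_smul, Complex.norm_real,
    Complex.conj_ofReal, norm_inv, norm_norm, inv_mul_cancel₀ hu'.ne',
    inv_mul_cancel₀ hv'.ne'] at h1
  rw [← mul_assoc, ← mul_inv, inv_mul_le_iff₀ (by positivity)] at h1
  linarith

end Homogeneity

/-! ### The commutator estimate for integrable kernels -/

section Bounded

variable {Ω : Type*} [MeasurableSpace Ω] {ν : Measure Ω} {p : Ω → ℝ}

open ContinuousLinearMap (adjoint)

/-- The density whose integral against a symbol `m` is `⟪v, [M, G] u⟫`, for `M` the operator of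
multiplication by `m`. -/
def commDensity (G : Lp ℂ 2 ν →L[ℂ] Lp ℂ 2 ν) (u v : Lp ℂ 2 ν) (ξ : Ω) : ℂ :=
  starRingEnd ℂ (v ξ) * G u ξ - starRingEnd ℂ (adjoint G v ξ) * u ξ

theorem integrable_commDensity (G : Lp ℂ 2 ν →L[ℂ] Lp ℂ 2 ν) (u v : Lp ℂ 2 ν) :
    Integrable (commDensity G u v) ν :=
  (integrable_conj_mul v (G u)).sub (integrable_conj_mul (adjoint G v) u)

/-- Constants commute with everything: the term `s⁻¹` in the integral representation of the square
root does not contribute to a commutator. -/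
theorem integral_commDensity (G : Lp ℂ 2 ν →L[ℂ] Lp ℂ 2 ν) (u v : Lp ℂ 2 ν) :
    ∫ ξ, commDensity G u v ξ ∂ν = 0 := by
  simp only [commDensity]
  rw [integral_sub (integrable_conj_mul v (G u)) (integrable_conj_mul (adjoint G v) u),
    ← inner_eq_integral, ← inner_eq_integral, ContinuousLinearMap.adjoint_inner_left, sub_self]

theorem integral_mul_commDensity (G : Lp ℂ 2 ν →L[ℂ] Lp ℂ 2 ν) {m : Ω → ℝ} (hm : Measurable m)
    {C : ℝ} (hC : ∀ ξ, |m ξ| ≤ C) (u v : Lp ℂ 2 ν) :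
    Integrable (fun ξ => (m ξ : ℂ) * commDensity G u v ξ) ν ∧
    ∫ ξ, (m ξ : ℂ) * commDensity G u v ξ ∂ν =
      ⟪realMulLp ν hm hC v, G u⟫ - ⟪v, G (realMulLp ν hm hC u)⟫ := by
  have hb : ∀ w : Ω → ℂ, Integrable w ν → Integrable (fun ξ => (m ξ : ℂ) * w ξ) ν := fun w hw =>
    hw.bdd_mul (c := C) (by fun_prop)
      (ae_of_all _ fun ξ => by rw [Complex.norm_real]; exact hC ξ)
  refine ⟨hb _ (integrable_commDensity G u v), ?_⟩
  rw [← ContinuousLinearMap.adjoint_inner_left G (realMulLp ν hm hC u), inner_mulLp_right,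
    inner_mulLp_left,
    ← integral_sub]
  · simp only [commDensity, mul_sub]
  · exact hb _ (integrable_conj_mul _ _)
  · exact hb _ (integrable_conj_mul _ _)
  · simp

/-- Bound for `s ^ (1/2)` times the commutator of the resolvent at `s`: trivial for `s ≤ 1`, from
the decay of the commutator for `s > 1`. -/
def resolventBound (α σ c s : ℝ) : ℝ :=
  (Ioc 0 1).indicator (fun s => s ^ (-1 / 2 : ℝ)) s + (Ioi 1).indicator (fun s =>
    (c / (2 * (2 * σ - α)) + c / (α - σ) + 1 / 2) * s ^ (-1 / 2 - σ / α)) s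

/-- The constant in the commutator estimate for the square root of a jump generator. -/
def commConst (α σ c : ℝ) : ℝ := 2 * (sqrtConst⁻¹ * ∫ s in Ioi 0, resolventBound α σ c s)

/-- Integrability at infinity is where `σ > α / 2` enters. -/
theorem integrableOn_resolventBound {α σ c : ℝ} (hα : 0 < α) (hασ : α < 2 * σ) :
    IntegrableOn (resolventBound α σ c) (Ioi 0) := by
  refine (Integrable.add ?_ ?_).integrableOn
  · rw [integrable_indicator_iff measurableSet_Ioc,
      ← intervalIntegrable_iff_integrableOn_Ioc_of_le zero_le_one]
    exact intervalIntegral.intervalIntegrable_rpow' (by norm_num)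
  · rw [integrable_indicator_iff measurableSet_Ioi]
    refine (integrableOn_Ioi_rpow_of_lt ?_ one_pos).const_mul _
    have : 1 / 2 < σ / α := by rw [div_lt_div_iff₀ two_pos hα]; linarith
    linarith

theorem commConst_nonneg {α σ c : ℝ} (hc : 0 ≤ c) (hσα : σ < α) (hασ : α < 2 * σ) :
    0 ≤ commConst α σ c := by
  have h1 : 0 < 2 * σ - α := by linarith
  have h2 : 0 < α - σ := by linarith
  refine mul_nonneg zero_le_two (mul_nonneg (inv_nonneg.2 sqrtConst_pos.le)
    (setIntegral_nonneg measurableSet_Ioi fun s hs => add_nonneg ?_ ?_))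
  · exact indicator_nonneg (fun s hs => Real.rpow_nonneg hs.1.le _) _
  · refine indicator_nonneg (fun s hs => ?_) _
    have : 0 < s := one_pos.trans hs
    positivity

/-- The commutator estimate for the square root of a bounded jump generator. The bound does not
depend on the norm of the generator, hence survives the passage to singular kernels. -/
theorem norm_integral_sqrt_commDensity_le [SFinite ν] (hp : Measurable p) {k : ℝ → ℝ}
    (hkm : Measurable k) (hk : Integrable k) (hk₀ : ∀ z, 0 ≤ k z) (heven : ∀ z, k (-z) = k z)
    {α σ c K : ℝ} (hα : 0 < α) (hK : 0 ≤ K) (hc : 0 ≤ c) (hσα : σ < α) (hασ : α < 2 * σ)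
    (hkc : ∀ z, z ≠ 0 → k z ≤ c * |z| ^ (-1 - α)) {G : Lp ℂ 2 ν →L[ℂ] Lp ℂ 2 ν}
    (hGK : ∀ x, ‖G x‖ ≤ K * ‖x‖)
    (hG : ∀ z x, ‖phase ν hp z (G x) - G (phase ν hp z x)‖ ≤ K * |z| ^ σ * ‖x‖)
    (u v : Lp ℂ 2 ν) :
    ‖∫ ξ, ((√(jumpSymbol k (p ξ)) : ℝ) : ℂ) * commDensity G u v ξ ∂ν‖ ≤
      commConst α σ c * K * (‖u‖ * ‖v‖) := by
  set A : Ω → ℝ := fun ξ => jumpSymbol k (p ξ) with hA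
  have hAm : Measurable A := (measurable_jumpSymbol hkm).comp hp
  have hA₀ : ∀ ξ, 0 ≤ A ξ := fun ξ => jumpSymbol_nonneg hk₀ _
  set C := 2 * ∫ z, |k z| with hC
  have hAC : ∀ ξ, |A ξ| ≤ C := fun ξ => abs_jumpSymbol_le hk _
  have hgen : IsJumpGenerator k (phase ν hp) (realMulLp ν hAm hAC) :=
    isJumpGenerator_mulLp hp hk hk₀ heven hAm hAC
  have hsm : Measurable fun ξ => √(A ξ) := hAm.sqrt
  have hsC : ∀ ξ, |√(A ξ)| ≤ √C := fun ξ => by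
    rw [abs_of_nonneg (Real.sqrt_nonneg _)]
    exact Real.sqrt_le_sqrt ((le_abs_self _).trans (hAC ξ))
  set T := realMulLp ν hsm hsC with hT
  have hTsymm : ∀ x y, ⟪T x, y⟫ = ⟪x, T y⟫ := fun x y => by
    rw [hT, inner_mulLp_right, inner_mulLp_left]
    simp
  have hrepr : ∀ u v, ∫ ξ, ((√(A ξ) : ℝ) : ℂ) * commDensity G u v ξ ∂ν =
      ⟪v, (T * G - G * T) u⟫ := by
    intro u v
    rw [(integral_mul_commDensity G hsm hsC u v).2, ← hT, hTsymm]
    simp only [sub_apply, mul_apply_eq_comp, inner_sub_right]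
  have key : ∀ u v, ‖⟪v, (T * G - G * T) u⟫‖ ≤
      (sqrtConst⁻¹ * ∫ s in Ioi 0, resolventBound α σ c s) * K * (‖u‖ ^ 2 + ‖v‖ ^ 2) := by
    intro u v
    rw [← hrepr]
    have h1 := integral_sqrt_mul (integrable_commDensity G u v) hAm hA₀ hAC
    have h2 : ∀ s ∈ Ioi (0 : ℝ),
        ‖∫ ξ, (Real.rpowIntegrand₀₁ (1 / 2) s (A ξ) : ℂ) * commDensity G u v ξ ∂ν‖ ≤
        resolventBound α σ c s * (K * (‖u‖ ^ 2 + ‖v‖ ^ 2)) := by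
      intro s hs
      have hs0 : 0 < s := hs
      have hRm : Measurable fun ξ => (s + A ξ)⁻¹ := by fun_prop
      have hRC : ∀ ξ, |(s + A ξ)⁻¹| ≤ s⁻¹ := fun ξ => by
        have := hA₀ ξ
        rw [abs_of_nonneg (by positivity)]
        gcongr
        linarith
      have hR := isSymmResolvent_mulLp (ν := ν) hAm hA₀ hAC hs0 hRm hRC
      obtain ⟨hRi, hRe⟩ := integral_mul_commDensity G hRm hRC u v
      have h3 : ∫ ξ, (Real.rpowIntegrand₀₁ (1 / 2) s (A ξ) : ℂ) * commDensity G u v ξ ∂ν =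
          -((s ^ (1 / 2 : ℝ) : ℝ) : ℂ) *
            (⟪realMulLp ν hRm hRC v, G u⟫ - ⟪v, G (realMulLp ν hRm hRC u)⟫) := by
        rw [← hRe]
        calc _ = ∫ ξ, (((s ^ (1 / 2 : ℝ) * s⁻¹ : ℝ) : ℂ) * commDensity G u v ξ -
              ((s ^ (1 / 2 : ℝ) : ℝ) : ℂ) *
                ((((s + A ξ)⁻¹ : ℝ) : ℂ) * commDensity G u v ξ)) ∂ν := by
              congr 1 with ξ
              simp only [Real.rpowIntegrand₀₁]
              push_cast
              ring
          _ = _ := by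
              rw [integral_sub ((integrable_commDensity G u v).const_mul _) (hRi.const_mul _),
                integral_const_mul, integral_const_mul, integral_commDensity]
              ring
      have hspow : 0 < s ^ (1 / 2 : ℝ) := Real.rpow_pos_of_pos hs0 _
      rw [h3, norm_mul, norm_neg, Complex.norm_real, Real.norm_of_nonneg hspow.le]
      by_cases h1s : s ≤ 1
      · have hb : resolventBound α σ c s = s ^ (1 / 2 : ℝ) * s⁻¹ := by
          rw [resolventBound, indicator_of_mem (by exact ⟨hs0, h1s⟩),
            indicator_of_notMem (by simpa using h1s), add_zero, ← Real.rpow_neg_one,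
            ← Real.rpow_add hs0]
          norm_num
        rw [hb, mul_assoc]
        refine mul_le_mul_of_nonneg_left ?_ hspow.le
        have n1 := norm_mulLp_apply_le (μ := ν) (h := fun ξ => (((s + A ξ)⁻¹ : ℝ) : ℂ))
          (by fun_prop) (C := s⁻¹) (fun ξ => by rw [Complex.norm_real]; exact hRC ξ)
        calc _ ≤ ‖⟪realMulLp ν hRm hRC v, G u⟫‖ + ‖⟪v, G (realMulLp ν hRm hRC u)⟫‖ :=
              norm_sub_le _ _
          _ ≤ (s⁻¹ * ‖v‖) * (K * ‖u‖) + ‖v‖ * (K * (s⁻¹ * ‖u‖)) := by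
              refine add_le_add ((norm_inner_le_norm _ _).trans ?_)
                ((norm_inner_le_norm _ _).trans ?_)
              · exact mul_le_mul (n1 v) (hGK u) (norm_nonneg _) (by positivity)
              · exact mul_le_mul_of_nonneg_left ((hGK _).trans
                  (mul_le_mul_of_nonneg_left (n1 u) hK)) (norm_nonneg _)
          _ = s⁻¹ * (K * (2 * ‖u‖ * ‖v‖)) := by ring
          _ ≤ _ := by
              have := two_mul_le_add_sq ‖u‖ ‖v‖
              gcongr
      · have hb : resolventBound α σ c s = s ^ (1 / 2 : ℝ) *
            ((c / (2 * (2 * σ - α)) + c / (α - σ) + 1 / 2) * s ^ (-1 - σ / α)) := by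
          rw [resolventBound, indicator_of_notMem (fun h => h1s h.2),
            indicator_of_mem (by exact not_le.1 h1s), zero_add, mul_left_comm,
            ← Real.rpow_add hs0]
          congr 2
          ring
        rw [hb, mul_assoc]
        refine mul_le_mul_of_nonneg_left ?_ hspow.le
        exact (hgen.norm_inner_resolvent_comm_le hR hs0 hα hK hc hσα hασ hkc hG u v).trans_eq
          (by ring)
    have h4 := norm_integral_le_of_norm_le
      ((integrableOn_resolventBound (c := c) hα hασ).mul_const (K * (‖u‖ ^ 2 + ‖v‖ ^ 2)))
      ((ae_restrict_iff' measurableSet_Ioi).2 (ae_of_all _ h2))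
    rw [h1, norm_mul, Complex.norm_real, Real.norm_of_nonneg sqrtConst_pos.le,
      integral_mul_const] at h4
    rw [mul_assoc, mul_assoc]
    rwa [le_inv_mul_iff₀ sqrtConst_pos]
  rw [hrepr]
  refine (norm_inner_apply_le_of_sq key u v).trans_eq ?_
  rw [commConst]
  ring

end Bounded

/-! ### Singular kernels and their truncations -/

section Kernel

open Filter Topology

/-- A nonnegative even kernel supported in `[-a, a]` and at most as singular at the origin as that
of the fractional Laplacian of order `α`. -/
structure IsShortRange (α a c : ℝ) (k : ℝ → ℝ) : Prop where
  measurable : Measurable k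
  nonneg : ∀ z, 0 ≤ k z
  even : ∀ z, k (-z) = k z
  le : ∀ z, z ≠ 0 → k z ≤ c * |z| ^ (-1 - α)
  eq_zero : ∀ z, a < |z| → k z = 0

/-- The kernel with the jumps smaller than `1 / (n + 1)` removed. -/
def truncate (k : ℝ → ℝ) (n : ℕ) : ℝ → ℝ := {z : ℝ | |z| ≤ 1 / (n + 1)}ᶜ.indicator k

theorem measurableSet_abs_le (r : ℝ) : MeasurableSet {z : ℝ | |z| ≤ r} :=
  measurableSet_le (by fun_prop) (by fun_prop)

namespace IsShortRange

variable {α a c : ℝ} {k : ℝ → ℝ}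

theorem truncate_le (h : IsShortRange α a c k) (n : ℕ) (z : ℝ) : truncate k n z ≤ k z :=
  indicator_le_self' (fun _ _ => h.nonneg _) z

theorem truncate_isShortRange (h : IsShortRange α a c k) (n : ℕ) :
    IsShortRange α a c (truncate k n) where
  measurable := h.measurable.indicator (measurableSet_abs_le _).compl
  nonneg := fun z => indicator_nonneg (fun _ _ => h.nonneg _) z
  even := fun z => by simp [truncate, indicator, h.even]
  le := fun z hz => (h.truncate_le n z).trans (h.le z hz)
  eq_zero := fun z hz => by simp [truncate, indicator, h.eq_zero z hz]

theorem integrable_truncate (h : IsShortRange α a c k) (hα : 0 < α) (n : ℕ) :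
    Integrable (truncate k n) := by
  rw [truncate, integrable_indicator_iff (measurableSet_abs_le _).compl]
  refine (integrableOn_lt_abs_of_le_rpow (γ := 0) (r := 1 / (n + 1))
    h.measurable.aestronglyMeasurable h.nonneg h.le hα (by positivity)).1.congr
    (ae_of_all _ fun z => ?_)
  simp

theorem integrable_mul_rpow (h : IsShortRange α a c k) (ha : 0 ≤ a) {γ : ℝ} (hγ₀ : 0 < γ)
    (hγ : α < γ) : Integrable fun z => k z * |z| ^ γ := by
  have h1 := (integrableOn_abs_le_of_le_rpow h.measurable.aestronglyMeasurable h.nonneg h.le hγ₀ hγ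
    ha).1
  rw [← integrable_indicator_iff (measurableSet_abs_le _)] at h1
  refine h1.congr (ae_of_all _ fun z => ?_)
  by_cases hz : |z| ≤ a
  · exact indicator_of_mem (by exact hz) _
  · simp only [indicator_of_notMem (show z ∉ {z : ℝ | |z| ≤ a} from hz),
      h.eq_zero z (not_le.1 hz), zero_mul]

theorem integrable_symbol (h : IsShortRange α a c k) (ha : 0 ≤ a) (hα : α < 2) (ζ : ℝ) :
    Integrable fun z => (1 - Real.cos (ζ * z)) * k z := by
  refine ((h.integrable_mul_rpow ha two_pos hα).const_mul (ζ ^ 2 / 2)).mono'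
    (Measurable.aestronglyMeasurable (by have := h.measurable; fun_prop))
    (ae_of_all _ fun z => ?_)
  rw [norm_mul, Real.norm_of_nonneg (one_sub_cos_mem _).1, Real.norm_of_nonneg (h.nonneg z),
    Real.rpow_two, sq_abs]
  have h1 := Real.one_sub_sq_div_two_le_cos (x := ζ * z)
  have h2 : 1 - Real.cos (ζ * z) ≤ ζ ^ 2 / 2 * z ^ 2 := by
    rw [mul_pow] at h1; linarith
  calc _ ≤ ζ ^ 2 / 2 * z ^ 2 * k z := mul_le_mul_of_nonneg_right h2 (h.nonneg z)
    _ = _ := by ring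

theorem jumpSymbol_truncate_le (h : IsShortRange α a c k) (ha : 0 ≤ a) (hα : α < 2) (n : ℕ)
    (ζ : ℝ) : jumpSymbol (truncate k n) ζ ≤ jumpSymbol k ζ :=
  integral_mono ((h.truncate_isShortRange n).integrable_symbol ha hα ζ)
    (h.integrable_symbol ha hα ζ)
    fun z => mul_le_mul_of_nonneg_left (h.truncate_le n z) (one_sub_cos_mem _).1

theorem tendsto_jumpSymbol_truncate (h : IsShortRange α a c k) (ha : 0 ≤ a) (hα : α < 2) (ζ : ℝ) :
    Tendsto (fun n => jumpSymbol (truncate k n) ζ) atTop (𝓝 (jumpSymbol k ζ)) := by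
  refine tendsto_integral_of_dominated_convergence (fun z => (1 - Real.cos (ζ * z)) * k z)
    (fun n => ((h.truncate_isShortRange n).integrable_symbol ha hα ζ).aestronglyMeasurable)
    (h.integrable_symbol ha hα ζ) (fun n => ae_of_all _ fun z => ?_) (ae_of_all _ fun z => ?_)
  · rw [norm_mul, Real.norm_of_nonneg (one_sub_cos_mem _).1,
      Real.norm_of_nonneg ((h.truncate_isShortRange n).nonneg z)]
    exact mul_le_mul_of_nonneg_left (h.truncate_le n z) (one_sub_cos_mem _).1
  · rcases eq_or_ne z 0 with rfl | hz
    · simp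
    · refine tendsto_const_nhds.congr' ?_
      filter_upwards [tendsto_one_div_add_atTop_nhds_zero_nat.eventually_lt_const (abs_pos.2 hz)]
        with n hn
      rw [truncate, indicator_of_mem]
      simpa using hn

end IsShortRange
end Kernel

/-! ### The commutator estimate for singular kernels -/

section Regularity

open Filter Topology
open ContinuousLinearMap (adjoint)

variable {Ω : Type*} [MeasurableSpace Ω] {ν : Measure Ω} {p : Ω → ℝ}

/-- The elements of `L²` that are Hölder continuous of exponent `σ` along the translations, seen
on the Fourier side. -/
def holderSubmodule (ν : Measure Ω) (hp : Measurable p) (σ : ℝ) : Submodule ℂ (Lp ℂ 2 ν) where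
  carrier := {v | ∃ D, ∀ z, ‖phase ν hp z v - v‖ ≤ D * |z| ^ σ}
  zero_mem' := ⟨0, fun z => by simp⟩
  add_mem' := by
    rintro v w ⟨D, hD⟩ ⟨D', hD'⟩
    refine ⟨D + D', fun z => ?_⟩
    rw [map_add, add_sub_add_comm, add_mul]
    exact (norm_add_le _ _).trans (add_le_add (hD z) (hD' z))
  smul_mem' := by
    rintro t v ⟨D, hD⟩
    refine ⟨‖t‖ * D, fun z => ?_⟩
    rw [map_smul, ← smul_sub, norm_smul, mul_assoc]
    exact mul_le_mul_of_nonneg_left (hD z) (norm_nonneg t)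

/-- The commutator of the adjoint of `G` with a unitary group obeys the same bound as that of
`G`. -/
theorem norm_comm_adjoint_le {H : Type*} [NormedAddCommGroup H] [InnerProductSpace ℂ H]
    [CompleteSpace H] {E : ℝ → H →ₗᵢ[ℂ] H} (hE : ∀ z x, E z (E (-z) x) = x) {G : H →L[ℂ] H}
    {κ z : ℝ} (hG : ∀ x, ‖E (-z) (G x) - G (E (-z) x)‖ ≤ κ * ‖x‖) (x : H) :
    ‖E z (adjoint G x) - adjoint G (E z x)‖ ≤ κ * ‖x‖ := by
  set y := E z (adjoint G x) - adjoint G (E z x) with hy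
  have hE' : ∀ a b, ⟪a, E z b⟫ = ⟪E (-z) a, b⟫ := fun a b => by
    have := inner_apply_neg hE (-z) a b
    rwa [neg_neg] at this
  have h1 : ∀ w, ⟪w, y⟫ = -⟪E (-z) (G w) - G (E (-z) w), x⟫ := by
    intro w
    rw [hy, inner_sub_right, inner_sub_left, hE', ContinuousLinearMap.adjoint_inner_right,
      ContinuousLinearMap.adjoint_inner_right, hE']
    ring
  have h2 : ‖y‖ ^ 2 ≤ κ * ‖y‖ * ‖x‖ := by
    have : ‖y‖ ^ 2 = ‖⟪y, y⟫‖ := by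
      rw [inner_self_eq_norm_sq_to_K, norm_pow]
      simp
    rw [this, h1, norm_neg]
    exact (norm_inner_le_norm _ _).trans (mul_le_mul_of_nonneg_right (hG y) (norm_nonneg x))
  rcases (norm_nonneg y).eq_or_lt with h0 | h0
  · rw [← h0]
    have h3 := (norm_nonneg _).trans (hG x)
    exact h3
  · refine le_of_mul_le_mul_left ?_ h0
    linarith

theorem adjoint_mem_holderSubmodule (hp : Measurable p) {σ K : ℝ}
    {G : Lp ℂ 2 ν →L[ℂ] Lp ℂ 2 ν}
    (hG : ∀ z x, ‖phase ν hp z (G x) - G (phase ν hp z x)‖ ≤ K * |z| ^ σ * ‖x‖)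
    {v : Lp ℂ 2 ν} (hv : v ∈ holderSubmodule ν hp σ) : adjoint G v ∈ holderSubmodule ν hp σ := by
  obtain ⟨D, hD⟩ := hv
  refine ⟨K * ‖v‖ + ‖adjoint G‖ * D, fun z => ?_⟩
  have h1 := norm_comm_adjoint_le (E := phase ν hp) (phase_apply_neg hp) (hG (-z)) v
  rw [abs_neg] at h1
  have h2 : phase ν hp z (adjoint G v) - adjoint G v =
      (phase ν hp z (adjoint G v) - adjoint G (phase ν hp z v)) +
        adjoint G (phase ν hp z v - v) := by
    rw [map_sub]; abel
  rw [h2]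
  calc _ ≤ K * |z| ^ σ * ‖v‖ + ‖adjoint G‖ * (D * |z| ^ σ) :=
        (norm_add_le _ _).trans (add_le_add h1 ((adjoint G).le_opNorm_of_le (hD z)))
    _ = _ := by ring

variable {α a c : ℝ} {k : ℝ → ℝ}

/-- An element of `L²` that is Hölder continuous of an exponent larger than `α / 2` is in the form
domain of the generator, by Fatou's lemma for the truncated kernels. -/
theorem memLp_sqrt_jumpSymbol_mul [SFinite ν] (hk : IsShortRange α a c k) (hp : Measurable p)
    (ha : 0 ≤ a) (hα₀ : 0 < α) (hα₂ : α < 2) {σ : ℝ} (hσ : α < 2 * σ) {v : Lp ℂ 2 ν}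
    (hv : v ∈ holderSubmodule ν hp σ) :
    MemLp (fun ξ => ((√(jumpSymbol k (p ξ)) : ℝ) : ℂ) * v ξ) 2 ν := by
  obtain ⟨D, hD⟩ := hv
  have hmeas : ∀ {k : ℝ → ℝ}, Measurable k →
      Measurable fun ξ => ((√(jumpSymbol k (p ξ)) : ℝ) : ℂ) := fun hk => by
    have := (measurable_jumpSymbol hk).comp hp
    exact Complex.measurable_ofReal.comp this.sqrt
  have haesm : ∀ {k : ℝ → ℝ}, Measurable k →
      AEStronglyMeasurable (fun ξ => ((√(jumpSymbol k (p ξ)) : ℝ) : ℂ) * v ξ) ν := fun hk =>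
    (hmeas hk).aestronglyMeasurable.mul (Lp.aestronglyMeasurable v)
  refine ⟨haesm hk.measurable, ?_⟩
  set M : ℝ := √(D ^ 2 / 2 * ∫ z, k z * |z| ^ (2 * σ)) with hM
  have hi := hk.integrable_mul_rpow ha (γ := 2 * σ) (by linarith) hσ
  have hbound : ∀ n, eLpNorm (fun ξ => ((√(jumpSymbol (truncate k n) (p ξ)) : ℝ) : ℂ) * v ξ) 2 ν ≤
      ENNReal.ofReal M := by
    intro n
    have hkn := hk.truncate_isShortRange n
    have hin := hk.integrable_truncate hα₀ n
    set A : Ω → ℝ := fun ξ => jumpSymbol (truncate k n) (p ξ) with hA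
    have hAm : Measurable A := (measurable_jumpSymbol hkn.measurable).comp hp
    have hA₀ : ∀ ξ, 0 ≤ A ξ := fun ξ => jumpSymbol_nonneg hkn.nonneg _
    set C := 2 * ∫ z, |truncate k n z| with hC
    have hAC : ∀ ξ, |A ξ| ≤ C := fun ξ => abs_jumpSymbol_le hin _
    have hgen : IsJumpGenerator (truncate k n) (phase ν hp) (realMulLp ν hAm hAC) :=
      isJumpGenerator_mulLp hp hin hkn.nonneg hkn.even hAm hAC
    have hsm : Measurable fun ξ => √(A ξ) := hAm.sqrt
    have hsC : ∀ ξ, |√(A ξ)| ≤ √C := fun ξ => by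
      rw [abs_of_nonneg (Real.sqrt_nonneg _)]
      exact Real.sqrt_le_sqrt ((le_abs_self _).trans (hAC ξ))
    have h1 : ‖realMulLp ν hsm hsC v‖ ^ 2 = (⟪v, realMulLp ν hAm hAC v⟫).re := by
      rw [← inner_self_eq_norm_sq (𝕜 := ℂ), inner_mulLp_left _ _ (by simp), inner_mulLp_right,
        RCLike.re_eq_complex_re]
      congr 1
      refine integral_congr_ae ?_
      filter_upwards [coeFn_mulLp (μ := ν) (h := fun ξ => ((√(A ξ) : ℝ) : ℂ)) (by fun_prop)
        (C := √C) (fun ξ => by rw [Complex.norm_real]; exact hsC ξ) v] with ξ hξ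
      have h2 : ((√(A ξ) : ℝ) : ℂ) * ((√(A ξ) : ℝ) : ℂ) = (A ξ : ℂ) := by
        rw [← Complex.ofReal_mul, Real.mul_self_sqrt (hA₀ ξ)]
      rw [hξ, ← h2]
      ring
    have h3 : ‖realMulLp ν hsm hsC v‖ ^ 2 ≤ D ^ 2 / 2 * ∫ z, k z * |z| ^ (2 * σ) := by
      have h4 := hgen.integral_norm_sq v
      have h5 : ∫ z, truncate k n z * ‖v - phase ν hp z v‖ ^ 2 ≤
          ∫ z, D ^ 2 * (k z * |z| ^ (2 * σ)) := by
        refine integral_mono (hgen.integrable_norm_sq v) (hi.const_mul _) fun z => ?_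
        have h6 : ‖v - phase ν hp z v‖ ^ 2 ≤ (D * |z| ^ σ) ^ 2 := by
          rw [norm_sub_rev]
          exact pow_le_pow_left₀ (norm_nonneg _) (hD z) 2
        calc _ ≤ k z * (D * |z| ^ σ) ^ 2 :=
              mul_le_mul (hk.truncate_le n z) h6 (by positivity) (hk.nonneg z)
          _ = _ := by
              rw [mul_comm 2 σ, Real.rpow_mul (abs_nonneg z), Real.rpow_two]
              ring
      rw [integral_const_mul] at h5
      linarith
    have h7 : ‖realMulLp ν hsm hsC v‖ ≤ M := Real.le_sqrt_of_sq_le h3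
    rw [← eLpNorm_congr_ae (coeFn_mulLp (μ := ν) (h := fun ξ => ((√(A ξ) : ℝ) : ℂ)) (by fun_prop)
        (C := √C) (fun ξ => by rw [Complex.norm_real]; exact hsC ξ) v)]
    rw [← ENNReal.ofReal_toReal (Lp.eLpNorm_ne_top (realMulLp ν hsm hsC v))]
    exact ENNReal.ofReal_le_ofReal h7
  refine (Lp.eLpNorm_lim_le_liminf_eLpNorm
    (fun n => haesm (hk.truncate_isShortRange n).measurable) _
    (ae_of_all _ fun ξ => ?_)).trans_lt ?_
  · refine Tendsto.mul_const _ ?_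
    exact (Complex.continuous_ofReal.tendsto _).comp
      ((Real.continuous_sqrt.tendsto _).comp (hk.tendsto_jumpSymbol_truncate ha hα₂ _))
  · refine lt_of_le_of_lt ?_ (ENNReal.ofReal_lt_top (r := M))
    exact (liminf_le_of_le (by isBoundedDefault) fun b hb => by
      obtain ⟨n, hn⟩ := hb.exists
      exact hn.trans (hbound n))

theorem integrable_mul_commDensity {m : Ω → ℝ} {G : Lp ℂ 2 ν →L[ℂ] Lp ℂ 2 ν} {u v : Lp ℂ 2 ν}
    (h₁ : MemLp (fun ξ => (m ξ : ℂ) * v ξ) 2 ν)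
    (h₂ : MemLp (fun ξ => (m ξ : ℂ) * adjoint G v ξ) 2 ν) :
    Integrable (fun ξ => (m ξ : ℂ) * (starRingEnd ℂ (v ξ) * G u ξ)) ν ∧
    Integrable (fun ξ => (m ξ : ℂ) * (starRingEnd ℂ (adjoint G v ξ) * u ξ)) ν ∧
    Integrable (fun ξ => (m ξ : ℂ) * commDensity G u v ξ) ν := by
  have aux : ∀ {x y : Ω → ℂ}, MemLp (fun ξ => (m ξ : ℂ) * x ξ) 2 ν → MemLp y 2 ν →
      Integrable (fun ξ => (m ξ : ℂ) * (starRingEnd ℂ (x ξ) * y ξ)) ν := by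
    intro x y hx hy
    refine (hx.star.integrable_mul hy).congr (ae_of_all _ fun ξ => ?_)
    simp [mul_assoc]
  have i₁ := aux h₁ (Lp.memLp (G u))
  have i₂ := aux h₂ (Lp.memLp u)
  refine ⟨i₁, i₂, (i₁.sub i₂).congr (ae_of_all _ fun ξ => ?_)⟩
  simp only [Pi.sub_apply, commDensity]
  ring

/-- The commutator estimate for the square root of the generator of a short range kernel, by
truncation of the kernel at the origin. -/
theorem norm_integral_sqrt_commDensity_le_of_mem [SFinite ν]
    (hk : IsShortRange α a c k) (hp : Measurable p)
    (ha : 0 ≤ a) (hα₀ : 0 < α) (hα₂ : α < 2) {σ K : ℝ} (hK : 0 ≤ K) (hc : 0 ≤ c) (hσα : σ < α)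
    (hασ : α < 2 * σ) {G : Lp ℂ 2 ν →L[ℂ] Lp ℂ 2 ν} (hGK : ∀ x, ‖G x‖ ≤ K * ‖x‖)
    (hG : ∀ z x, ‖phase ν hp z (G x) - G (phase ν hp z x)‖ ≤ K * |z| ^ σ * ‖x‖)
    (u : Lp ℂ 2 ν) {v : Lp ℂ 2 ν} (hv : v ∈ holderSubmodule ν hp σ) :
    ‖∫ ξ, ((√(jumpSymbol k (p ξ)) : ℝ) : ℂ) * commDensity G u v ξ ∂ν‖ ≤
      commConst α σ c * K * (‖u‖ * ‖v‖) := by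
  have hint := (integrable_mul_commDensity (u := u)
    (memLp_sqrt_jumpSymbol_mul hk hp ha hα₀ hα₂ hασ hv)
    (memLp_sqrt_jumpSymbol_mul hk hp ha hα₀ hα₂ hασ (adjoint_mem_holderSubmodule hp hG hv))).2.2
  have hlim := tendsto_integral_of_dominated_convergence (μ := ν)
    (F := fun n ξ => ((√(jumpSymbol (truncate k n) (p ξ)) : ℝ) : ℂ) * commDensity G u v ξ)
    (f := fun ξ => ((√(jumpSymbol k (p ξ)) : ℝ) : ℂ) * commDensity G u v ξ)
    (fun ξ => ‖((√(jumpSymbol k (p ξ)) : ℝ) : ℂ) * commDensity G u v ξ‖)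
    (fun n => by
      refine AEStronglyMeasurable.mul ?_ (integrable_commDensity G u v).aestronglyMeasurable
      have := (measurable_jumpSymbol (hk.truncate_isShortRange n).measurable).comp hp
      exact (Complex.measurable_ofReal.comp this.sqrt).aestronglyMeasurable)
    hint.norm
    (fun n => ae_of_all _ fun ξ => by
      rw [norm_mul, norm_mul, Complex.norm_real, Complex.norm_real,
        Real.norm_of_nonneg (Real.sqrt_nonneg _), Real.norm_of_nonneg (Real.sqrt_nonneg _)]
      exact mul_le_mul_of_nonneg_right
        (Real.sqrt_le_sqrt (hk.jumpSymbol_truncate_le ha hα₂ n _)) (norm_nonneg _))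
    (ae_of_all _ fun ξ => by
      refine Tendsto.mul_const _ ?_
      exact (Complex.continuous_ofReal.tendsto _).comp
        ((Real.continuous_sqrt.tendsto _).comp (hk.tendsto_jumpSymbol_truncate ha hα₂ _)))
  refine le_of_tendsto hlim.norm (Eventually.of_forall fun n => ?_)
  have hkn := hk.truncate_isShortRange n
  exact norm_integral_sqrt_commDensity_le hp hkn.measurable (hk.integrable_truncate hα₀ n)
    hkn.nonneg hkn.even hα₀ hK hc hσα hασ hkn.le hGK hG u v

/-- The commutator estimate is stable under bounded perturbations of the symbol. -/
theorem norm_integral_commDensity_le [SFinite ν] (hk : IsShortRange α a c k) (hp : Measurable p)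
    (ha : 0 ≤ a) (hα₀ : 0 < α) (hα₂ : α < 2) {σ K : ℝ} (hK : 0 ≤ K) (hc : 0 ≤ c) (hσα : σ < α)
    (hασ : α < 2 * σ) {m : Ω → ℝ} (hm : Measurable m) {b : ℝ}
    (hmb : ∀ ξ, |m ξ - √(jumpSymbol k (p ξ))| ≤ b)
    {G : Lp ℂ 2 ν →L[ℂ] Lp ℂ 2 ν} (hGK : ∀ x, ‖G x‖ ≤ K * ‖x‖)
    (hG : ∀ z x, ‖phase ν hp z (G x) - G (phase ν hp z x)‖ ≤ K * |z| ^ σ * ‖x‖)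
    (u : Lp ℂ 2 ν) {v : Lp ℂ 2 ν} (hv : v ∈ holderSubmodule ν hp σ) :
    MemLp (fun ξ => (m ξ : ℂ) * v ξ) 2 ν ∧
    ‖∫ ξ, (m ξ : ℂ) * commDensity G u v ξ ∂ν‖ ≤
      (commConst α σ c + 2 * b) * K * (‖u‖ * ‖v‖) := by
  have hAm : Measurable fun ξ => √(jumpSymbol k (p ξ)) :=
    ((measurable_jumpSymbol hk.measurable).comp hp).sqrt
  set d : Ω → ℝ := fun ξ => m ξ - √(jumpSymbol k (p ξ)) with hd
  have hdm : Measurable d := hm.sub hAm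
  have hmem : ∀ {v : Lp ℂ 2 ν}, v ∈ holderSubmodule ν hp σ →
      MemLp (fun ξ => (m ξ : ℂ) * v ξ) 2 ν := by
    intro v hv
    refine ((memLp_sqrt_jumpSymbol_mul hk hp ha hα₀ hα₂ hασ hv).add
      (memLp_bdd_mul (h := fun ξ => (d ξ : ℂ)) (by fun_prop) (C := b)
        (fun ξ => by rw [Complex.norm_real]; exact hmb ξ) (Lp.memLp v))).ae_eq
      (ae_of_all _ fun ξ => ?_)
    simp only [Pi.add_apply, hd]
    push_cast
    ring
  refine ⟨hmem hv, ?_⟩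
  have hint := (integrable_mul_commDensity (u := u)
    (memLp_sqrt_jumpSymbol_mul hk hp ha hα₀ hα₂ hασ hv)
    (memLp_sqrt_jumpSymbol_mul hk hp ha hα₀ hα₂ hασ (adjoint_mem_holderSubmodule hp hG hv))).2.2
  obtain ⟨hdi, hde⟩ := integral_mul_commDensity G hdm hmb u v
  have h1 : ∫ ξ, (m ξ : ℂ) * commDensity G u v ξ ∂ν =
      (∫ ξ, ((√(jumpSymbol k (p ξ)) : ℝ) : ℂ) * commDensity G u v ξ ∂ν) +
      ∫ ξ, (d ξ : ℂ) * commDensity G u v ξ ∂ν := by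
    rw [← integral_add hint hdi]
    congr 1 with ξ
    simp only [hd]
    push_cast
    ring
  have h2 := norm_integral_sqrt_commDensity_le_of_mem hk hp ha hα₀ hα₂ hK hc hσα hασ hGK hG u hv
  have n1 := norm_mulLp_apply_le (μ := ν) (h := fun ξ => (d ξ : ℂ)) (by fun_prop) (C := b)
    (fun ξ => by rw [Complex.norm_real]; exact hmb ξ)
  have h3 : ‖∫ ξ, (d ξ : ℂ) * commDensity G u v ξ ∂ν‖ ≤ 2 * b * K * (‖u‖ * ‖v‖) := by
    rw [hde]
    calc _ ≤ ‖⟪realMulLp ν hdm hmb v, G u⟫‖ + ‖⟪v, G (realMulLp ν hdm hmb u)⟫‖ :=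
          norm_sub_le _ _
      _ ≤ (b * ‖v‖) * (K * ‖u‖) + ‖v‖ * (K * (b * ‖u‖)) := by
          refine add_le_add ((norm_inner_le_norm _ _).trans ?_)
            ((norm_inner_le_norm _ _).trans ?_)
          · exact mul_le_mul (n1 v) (hGK u) (norm_nonneg _) ((norm_nonneg _).trans (n1 v))
          · exact mul_le_mul_of_nonneg_left ((hGK _).trans
              (mul_le_mul_of_nonneg_left (n1 u) hK)) (norm_nonneg _)
      _ = _ := by ring
  rw [h1]
  calc _ ≤ _ := norm_add_le _ _
    _ ≤ _ := add_le_add h2 h3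
    _ = _ := by ring

end Regularity

/-! ### The commutator as an element of a Hilbert space -/

section Transfer

open ContinuousLinearMap (adjoint)

variable {Ω : Type*} [MeasurableSpace Ω] {ν : Measure Ω} {p : Ω → ℝ}

theorem commDensity_add_right (G : Lp ℂ 2 ν →L[ℂ] Lp ℂ 2 ν) (u v w : Lp ℂ 2 ν) :
    commDensity G u (v + w) =ᵐ[ν] fun ξ => commDensity G u v ξ + commDensity G u w ξ := by
  filter_upwards [Lp.coeFn_add v w, Lp.coeFn_add (adjoint G v) (adjoint G w)] with ξ h1 h2
  rw [← map_add] at h2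
  simp only [commDensity, h1, h2, Pi.add_apply, map_add (starRingEnd ℂ)]
  ring

theorem commDensity_smul_right (G : Lp ℂ 2 ν →L[ℂ] Lp ℂ 2 ν) (u v : Lp ℂ 2 ν) (t : ℂ) :
    commDensity G u (t • v) =ᵐ[ν] fun ξ => starRingEnd ℂ t * commDensity G u v ξ := by
  filter_upwards [Lp.coeFn_smul t v, Lp.coeFn_smul t (adjoint G v)] with ξ h1 h2
  rw [← map_smul] at h2
  simp only [commDensity, h1, h2, Pi.smul_apply, smul_eq_mul, map_mul]
  ring

/-- If the commutator form with symbol `m` is bounded on a subspace of `L²`, it is represented by an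
element of `L²` (Hahn-Banach and Riesz). -/
theorem exists_inner_eq_integral_commDensity {m : Ω → ℝ} {G : Lp ℂ 2 ν →L[ℂ] Lp ℂ 2 ν}
    {S : Submodule ℂ (Lp ℂ 2 ν)} {u : Lp ℂ 2 ν} {B : ℝ} (hB : 0 ≤ B)
    (hint : ∀ v ∈ S, Integrable (fun ξ => (m ξ : ℂ) * commDensity G u v ξ) ν)
    (hbound : ∀ v ∈ S, ‖∫ ξ, (m ξ : ℂ) * commDensity G u v ξ ∂ν‖ ≤ B * ‖v‖) :
    ∃ y : Lp ℂ 2 ν, ‖y‖ ≤ B ∧ ∀ v ∈ S, ⟪v, y⟫ = ∫ ξ, (m ξ : ℂ) * commDensity G u v ξ ∂ν := by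
  let ℓ : S →ₗ[ℂ] ℂ :=
    { toFun := fun v => starRingEnd ℂ (∫ ξ, (m ξ : ℂ) * commDensity G u v ξ ∂ν)
      map_add' := fun v w => by
        rw [← map_add, ← integral_add (hint v v.2) (hint w w.2)]
        congr 1
        refine integral_congr_ae ?_
        filter_upwards [commDensity_add_right G u (v : Lp ℂ 2 ν) w] with ξ hξ
        rw [Submodule.coe_add, hξ, mul_add]
      map_smul' := fun t v => by
        rw [RingHom.id_apply, smul_eq_mul, ← Complex.conj_conj t, ← map_mul, ← integral_const_mul]
        congr 1
        refine integral_congr_ae ?_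
        filter_upwards [commDensity_smul_right G u (v : Lp ℂ 2 ν) t] with ξ hξ
        rw [Complex.conj_conj, Submodule.coe_smul, hξ]
        ring }
  let ℓc : StrongDual ℂ S := ℓ.mkContinuous B fun v => by
    change ‖starRingEnd ℂ (∫ ξ, (m ξ : ℂ) * commDensity G u v ξ ∂ν)‖ ≤ _
    rw [RCLike.norm_conj]
    exact hbound v v.2
  obtain ⟨g, hg, hgn⟩ := exists_extension_norm_eq S ℓc
  refine ⟨(InnerProductSpace.toDual ℂ _).symm g, ?_, fun v hv => ?_⟩
  · rw [LinearIsometryEquiv.norm_map, hgn]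
    exact LinearMap.mkContinuous_norm_le _ hB _
  · rw [← inner_conj_symm, InnerProductSpace.toDual_symm_apply]
    have h1 : g v = starRingEnd ℂ (∫ ξ, (m ξ : ℂ) * commDensity G u v ξ ∂ν) := hg ⟨v, hv⟩
    rw [h1, Complex.conj_conj]

variable [SFinite ν] {H : Type*} [NormedAddCommGroup H] [InnerProductSpace ℂ H] [CompleteSpace H]

/-- The commutator estimate on a Hilbert space `H` with translations `τ`, for which `F` is a
Fourier transform. The test elements are the `v` that are Hölder continuous along `τ`. The
estimate on `L² ν` is applied to `F G F*`. -/
theorem exists_commutator {α a c : ℝ} {k : ℝ → ℝ} (hk : IsShortRange α a c k) (hp : Measurable p)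
    (ha : 0 ≤ a) (hα₀ : 0 < α) (hα₂ : α < 2) {σ K : ℝ} (hK : 0 ≤ K) (hc : 0 ≤ c) (hσα : σ < α)
    (hασ : α < 2 * σ) {m : Ω → ℝ} (hm : Measurable m) {b : ℝ} (hb : 0 ≤ b)
    (hmb : ∀ ξ, |m ξ - √(jumpSymbol k (p ξ))| ≤ b)
    (F : H →ₗᵢ[ℂ] Lp ℂ 2 ν) {τ : ℝ → H → H} (hτ : ∀ z x, F (τ z x) = phase ν hp z (F x))
    {G : H →L[ℂ] H} (hGK : ∀ x, ‖G x‖ ≤ K * ‖x‖)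
    (hG : ∀ z x, ‖τ z (G x) - G (τ z x)‖ ≤ K * |z| ^ σ * ‖x‖) (f : H) :
    ∃ h : H, ‖h‖ ≤ (commConst α σ c + 2 * b) * K * ‖f‖ ∧
      ∀ v : H, (∃ D, ∀ z, ‖τ z v - v‖ ≤ D * |z| ^ σ) →
        Integrable (fun ξ => (m ξ : ℂ) * (starRingEnd ℂ (F v ξ) * F (G f) ξ)) ν ∧
        Integrable (fun ξ => (m ξ : ℂ) * (starRingEnd ℂ (F (adjoint G v) ξ) * F f ξ)) ν ∧
        ⟪v, h⟫ = (∫ ξ, (m ξ : ℂ) * (starRingEnd ℂ (F v ξ) * F (G f) ξ) ∂ν) -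
          ∫ ξ, (m ξ : ℂ) * (starRingEnd ℂ (F (adjoint G v) ξ) * F f ξ) ∂ν := by
  set Fc : H →L[ℂ] Lp ℂ 2 ν := F.toContinuousLinearMap with hFc
  have hFcF : ∀ x, Fc x = F x := fun x => rfl
  have hFF : ∀ x, adjoint Fc (F x) = x := fun x => by
    refine ext_inner_left ℂ fun y => ?_
    rw [ContinuousLinearMap.adjoint_inner_right, hFcF, F.inner_map_map]
  have hFn : ∀ y, ‖adjoint Fc y‖ ≤ ‖y‖ := fun y => by
    have h1 : ‖adjoint Fc‖ ≤ 1 := by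
      rw [LinearIsometryEquiv.norm_map]
      exact F.norm_toContinuousLinearMap_le
    simpa using (adjoint Fc).le_of_opNorm_le h1 y
  have hE' : ∀ z (x y : Lp ℂ 2 ν), ⟪x, phase ν hp z y⟫ = ⟪phase ν hp (-z) x, y⟫ := fun z x y => by
    have := inner_apply_neg (E := phase ν hp) (phase_apply_neg hp) (-z) x y
    rwa [neg_neg] at this
  -- the adjoint of `F` intertwines the translations as well, even if `F` is not surjective
  have hFτ : ∀ z y, adjoint Fc (phase ν hp z y) = τ z (adjoint Fc y) := fun z y => by
    refine ext_inner_left ℂ fun x => ?_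
    rw [ContinuousLinearMap.adjoint_inner_right, hFcF, hE', ← hτ, ← hFcF,
      ← ContinuousLinearMap.adjoint_inner_right, ← F.inner_map_map, ← F.inner_map_map x, hτ, hτ,
      hE']
  set G' : Lp ℂ 2 ν →L[ℂ] Lp ℂ 2 ν := Fc ∘L G ∘L adjoint Fc with hG'
  have hG'a : ∀ y, G' y = F (G (adjoint Fc y)) := fun y => rfl
  have hG'F : ∀ x, G' (F x) = F (G x) := fun x => by rw [hG'a, hFF]
  have hG'adj : ∀ x, adjoint G' (F x) = F (adjoint G x) := fun x => by
    refine ext_inner_left ℂ fun y => ?_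
    rw [ContinuousLinearMap.adjoint_inner_right, hG'a, F.inner_map_map,
      ← ContinuousLinearMap.adjoint_inner_right, ← hFcF,
      ← ContinuousLinearMap.adjoint_inner_left Fc]
  have hG'K : ∀ y, ‖G' y‖ ≤ K * ‖y‖ := fun y => by
    rw [hG'a, F.norm_map]
    exact (hGK _).trans (mul_le_mul_of_nonneg_left (hFn y) hK)
  have hG'σ : ∀ z y, ‖phase ν hp z (G' y) - G' (phase ν hp z y)‖ ≤ K * |z| ^ σ * ‖y‖ := by
    intro z y
    rw [hG'a, hG'a, hFτ, ← hτ, ← map_sub, F.norm_map]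
    exact (hG z _).trans (mul_le_mul_of_nonneg_left (hFn y) (by positivity))
  have hest := fun (u : Lp ℂ 2 ν) {v} (hv : v ∈ holderSubmodule ν hp σ) =>
    norm_integral_commDensity_le hk hp ha hα₀ hα₂ hK hc hσα hασ hm hmb hG'K hG'σ u hv
  have hadj := fun {v} (hv : v ∈ holderSubmodule ν hp σ) => adjoint_mem_holderSubmodule hp hG'σ hv
  have hint := fun {v} (hv : v ∈ holderSubmodule ν hp σ) =>
    integrable_mul_commDensity (G := G') (u := F f) (hest 0 hv).1 (hest 0 (hadj hv)).1
  have hcC := commConst_nonneg hc hσα hασ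
  obtain ⟨y, hyn, hy⟩ := exists_inner_eq_integral_commDensity (m := m) (G := G')
    (S := holderSubmodule ν hp σ) (u := F f)
    (B := (commConst α σ c + 2 * b) * K * ‖f‖) (by positivity)
    (fun v hv => (hint hv).2.2) (fun v hv => (hest (F f) hv).2.trans_eq (by
      rw [F.norm_map]; ring))
  refine ⟨adjoint Fc y, (hFn y).trans hyn, fun v ⟨D, hD⟩ => ?_⟩
  have hv : F v ∈ holderSubmodule ν hp σ := ⟨D, fun z => by
    rw [← hτ, ← map_sub, F.norm_map]
    exact hD z⟩
  obtain ⟨i1, i2, -⟩ := hint hv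
  rw [hG'adj] at i2
  rw [hG'F] at i1
  refine ⟨i1, i2, ?_⟩
  rw [ContinuousLinearMap.adjoint_inner_right, hFcF, hy _ hv, ← integral_sub i1 i2]
  simp only [commDensity, hG'F, hG'adj, mul_sub]

end Transfer

/-! ### Multiplication and translation in physical space -/

section Physical

variable {X : Type*} [MeasurableSpace X] {μ : Measure X}

/-- The commutator of a translation with the multiplication by `g` is bounded by the increment of
`g`. -/
theorem norm_comp_mulLp_sub_le {T : X → X} (hT : MeasurePreserving T μ μ) {g : X → ℂ}
    (hg : Measurable g) {C : ℝ} (hC : ∀ x, ‖g x‖ ≤ C) {B : ℝ} (hB : ∀ x, ‖g (T x) - g x‖ ≤ B)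
    (f : Lp ℂ 2 μ) :
    ‖Lp.compMeasurePreserving T hT (mulLp μ hg hC f) -
      mulLp μ hg hC (Lp.compMeasurePreserving T hT f)‖ ≤ B * ‖f‖ := by
  rw [← Lp.norm_compMeasurePreserving f hT]
  refine Lp.norm_le_mul_norm_of_ae_le_mul ?_
  filter_upwards [Lp.coeFn_sub (Lp.compMeasurePreserving T hT (mulLp μ hg hC f))
      (mulLp μ hg hC (Lp.compMeasurePreserving T hT f)),
    Lp.coeFn_compMeasurePreserving (mulLp μ hg hC f) hT,
    coeFn_mulLp hg hC (Lp.compMeasurePreserving T hT f),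
    Lp.coeFn_compMeasurePreserving f hT,
    hT.quasiMeasurePreserving.ae (coeFn_mulLp hg hC f)] with x h1 h2 h3 h4 h5
  rw [h1, Pi.sub_apply, h2, h3, h4, Function.comp_apply, Function.comp_apply, h5, ← sub_mul,
    norm_mul]
  exact mul_le_mul_of_nonneg_right (hB x) (norm_nonneg _)

theorem continuous_star_Lp : Continuous fun f : Lp ℂ 2 μ => star f := by
  refine (Isometry.of_dist_eq fun f g => ?_).continuous
  rw [Lp.dist_def, Lp.dist_def]
  congr 1
  refine eLpNorm_congr_norm_ae ?_
  filter_upwards [Lp.coeFn_star f, Lp.coeFn_star g] with x h1 h2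
  rw [Pi.sub_apply, h1, h2, Pi.star_apply, Pi.star_apply, ← star_sub, norm_star, Pi.sub_apply]

theorem integral_mul_eq_inner_star {h u : X → ℂ} (hh : MemLp h 2 μ) (hu : MemLp u 2 μ) :
    ∫ x, h x * u x ∂μ = ⟪star (hu.toLp u), hh.toLp h⟫ := by
  rw [inner_eq_integral]
  refine integral_congr_ae ?_
  filter_upwards [hh.coeFn_toLp, hu.coeFn_toLp, Lp.coeFn_star (hu.toLp u)] with x h1 h2 h3
  rw [h1, h3, Pi.star_apply, h2, Complex.star_def, Complex.conj_conj, mul_comm]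

theorem adjoint_mulLp_star {g : X → ℂ} (hg : Measurable g) {C : ℝ} (hC : ∀ x, ‖g x‖ ≤ C)
    {u : X → ℂ} (hu : MemLp u 2 μ) :
    ContinuousLinearMap.adjoint (mulLp μ hg hC) (star (hu.toLp u)) =
      star ((memLp_bdd_mul hg hC hu).toLp _) := by
  have hg' : Measurable fun x => starRingEnd ℂ (g x) :=
    Complex.continuous_conj.measurable.comp hg
  have hC' : ∀ x, ‖starRingEnd ℂ (g x)‖ ≤ C := fun x => by rw [RCLike.norm_conj]; exact hC x
  rw [adjoint_mulLp hg hC hg' hC' fun _ => rfl]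
  ext1
  filter_upwards [coeFn_mulLp hg' hC' (star (hu.toLp u)), Lp.coeFn_star (hu.toLp u),
    Lp.coeFn_star ((memLp_bdd_mul hg hC hu).toLp _), hu.coeFn_toLp,
    (memLp_bdd_mul hg hC hu).coeFn_toLp] with x h1 h2 h3 h4 h5
  rw [h1, h2, h3, Pi.star_apply, Pi.star_apply, h4, h5, star_mul']
  rfl

end Physical

section Lipschitz

variable {Ω : Type*} [MeasurableSpace Ω] {ν : Measure Ω} {p : Ω → ℝ}

/-- Interpolation between a Lipschitz bound and a uniform bound. -/
theorem le_mul_rpow_abs_of_le {σ L B x z : ℝ} (hσ₀ : 0 ≤ σ) (hσ : σ ≤ 1) (hL : 0 ≤ L) (hB : 0 ≤ B)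
    (h₁ : x ≤ L * |z|) (h₂ : x ≤ B) : x ≤ (L + B) * |z| ^ σ := by
  rcases le_total |z| 1 with hz | hz
  · have h3 : |z| ≤ |z| ^ σ := by
      rcases (abs_nonneg z).eq_or_lt with h0 | h0
      · rw [← h0]; positivity
      · simpa using Real.rpow_le_rpow_of_exponent_ge h0 hz hσ
    have h4 := mul_le_mul_of_nonneg_left h3 hL
    have h5 : 0 ≤ B * |z| ^ σ := by positivity
    linarith
  · have h3 : 1 ≤ |z| ^ σ := Real.one_le_rpow hz hσ₀
    have h4 := mul_le_mul_of_nonneg_left h3 hB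
    have h5 : 0 ≤ L * |z| ^ σ := by positivity
    linarith

/-- An element of `L²` with a derivative in `L²` is Hölder continuous along the translations. -/
theorem mem_holderSubmodule_of_memLp_mul (hp : Measurable p) {σ : ℝ} (hσ₀ : 0 ≤ σ) (hσ : σ ≤ 1)
    {v : Lp ℂ 2 ν} (hv : MemLp (fun ξ => (p ξ : ℂ) * v ξ) 2 ν) : v ∈ holderSubmodule ν hp σ := by
  refine ⟨‖hv.toLp _‖ + 2 * ‖v‖, fun z => ?_⟩
  refine le_mul_rpow_abs_of_le hσ₀ hσ (norm_nonneg _) (by positivity) ?_ ?_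
  · rw [mul_comm]
    refine Lp.norm_le_mul_norm_of_ae_le_mul ?_
    filter_upwards [Lp.coeFn_sub (phase ν hp z v) v, coeFn_phase hp z v, hv.coeFn_toLp]
      with ξ h1 h2 h3
    rw [h1, Pi.sub_apply, h2, h3, ← sub_one_mul, norm_mul, norm_mul, ← mul_assoc,
      Complex.norm_real, Real.norm_eq_abs, ← abs_mul, mul_comm z, mul_comm _ Complex.I]
    exact mul_le_mul_of_nonneg_right (Real.norm_exp_I_mul_ofReal_sub_one_le) (norm_nonneg _)
  · refine (norm_sub_le _ _).trans_eq ?_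
    rw [LinearIsometry.norm_map]
    ring

end Lipschitz

/-! ### The line -/

section Line

theorem measurePreserving_translate (z : ℝ) :
    MeasurePreserving (fun x : ℝ => x + z) volume volume := measurePreserving_add_right volume z

/-- The frequency `ζ = 2πξ` of the character `x ↦ exp (2πi ξ x)`. -/
def lineFreq (ξ : ℝ) : ℝ := 2 * Real.pi * ξ

theorem measurable_lineFreq : Measurable lineFreq := by unfold lineFreq; fun_prop

theorem fourier_compMeasurePreserving (z : ℝ) (f : Lp ℂ 2 (volume : Measure ℝ)) :
    Lp.fourierTransformₗᵢ ℝ ℂ (Lp.compMeasurePreserving _ (measurePreserving_translate z) f) =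
      phase volume measurable_lineFreq z (Lp.fourierTransformₗᵢ ℝ ℂ f) := by
  refine DenseRange.induction_on (p := fun f : Lp ℂ 2 (volume : Measure ℝ) =>
    Lp.fourierTransformₗᵢ ℝ ℂ (Lp.compMeasurePreserving _ (measurePreserving_translate z) f) =
      phase volume measurable_lineFreq z (Lp.fourierTransformₗᵢ ℝ ℂ f))
    (SchwartzMap.denseRange_toLpCLM (p := 2) (F := ℂ) (E := ℝ) ENNReal.ofNat_ne_top) f
    (isClosed_eq ?_ ?_) fun ψ => ?_
  · exact (LinearIsometryEquiv.continuous _).comp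
      (Lp.compMeasurePreservingₗᵢ ℂ _ (measurePreserving_translate z)).continuous
  · exact (phase volume measurable_lineFreq z).continuous.comp (LinearIsometryEquiv.continuous _)
  · set ψ' : 𝓢(ℝ, ℂ) := ψ.compSubConstCLM ℝ (-z) with hψ'
    have h1 : Lp.compMeasurePreserving _ (measurePreserving_translate z) (ψ.toLp 2 volume) =
        ψ'.toLp 2 := by
      ext1
      filter_upwards [Lp.coeFn_compMeasurePreserving (ψ.toLp 2 volume)
          (measurePreserving_translate z),
        (measurePreserving_translate z).quasiMeasurePreserving.ae
          (show ∀ᵐ x, ψ.toLp 2 volume x = ψ x from ψ.coeFn_toLp 2 volume),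
        ψ'.coeFn_toLp 2] with x h1 h2 h3
      rw [h1, h3, Function.comp_apply, h2, hψ', SchwartzMap.compSubConstCLM_apply, sub_neg_eq_add]
    rw [SchwartzMap.toLpCLM_apply, h1]
    change 𝓕 (ψ'.toLp 2) = phase volume measurable_lineFreq z (𝓕 (ψ.toLp 2 volume))
    rw [SchwartzMap.toLp_fourier_eq, SchwartzMap.toLp_fourier_eq]
    ext1
    filter_upwards [coeFn_phase measurable_lineFreq z ((𝓕 ψ).toLp 2), (𝓕 ψ).coeFn_toLp 2,
      (𝓕 ψ').coeFn_toLp 2] with ξ h2 h3 h4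
    rw [h2, h3, h4, SchwartzMap.fourier_coe, SchwartzMap.fourier_coe]
    have h5 := congrFun (VectorFourier.fourierIntegral_comp_add_right Real.fourierChar
      (volume : Measure ℝ) (innerₗ ℝ) (ψ : ℝ → ℂ) z) ξ
    have h6 : (ψ' : ℝ → ℂ) = ψ ∘ fun v => v + z := by
      ext x
      rw [hψ', SchwartzMap.compSubConstCLM_apply, sub_neg_eq_add]
      rfl
    rw [h6]
    refine h5.trans ?_
    rw [Circle.smul_def, Real.fourierChar_apply, smul_eq_mul]
    congr 2
    simp [lineFreq]
    ring

theorem star_fourierInv (f : Lp ℂ 2 (volume : Measure ℝ)) :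
    star (𝓕⁻ f) = 𝓕 (star f) := by
  refine DenseRange.induction_on (p := fun f : Lp ℂ 2 (volume : Measure ℝ) =>
    star (𝓕⁻ f) = 𝓕 (star f))
    (SchwartzMap.denseRange_toLpCLM (p := 2) (F := ℂ) (E := ℝ) ENNReal.ofNat_ne_top) f
    (isClosed_eq ?_ ?_) fun ψ => ?_
  · exact continuous_star_Lp.comp (Lp.fourierTransformₗᵢ ℝ ℂ).symm.continuous
  · exact (Lp.fourierTransformₗᵢ ℝ ℂ).continuous.comp continuous_star_Lp
  · set ψ' : 𝓢(ℝ, ℂ) := ψ.postcompCLM (Complex.conjCLE : ℂ →L[ℝ] ℂ) with hψ'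
    have h1 : ∀ x, ψ' x = starRingEnd ℂ (ψ x) := fun x => by simp [hψ']
    have h2 : star (ψ.toLp 2 volume) = ψ'.toLp 2 := by
      ext1
      filter_upwards [Lp.coeFn_star (ψ.toLp 2 volume), ψ.coeFn_toLp 2,
        ψ'.coeFn_toLp 2] with x e1 e2 e3
      rw [e1, Pi.star_apply, e2, e3, h1]
      rfl
    rw [SchwartzMap.toLpCLM_apply, h2, SchwartzMap.toLp_fourier_eq, SchwartzMap.toLp_fourierInv_eq]
    ext1
    filter_upwards [Lp.coeFn_star ((𝓕⁻ ψ).toLp 2 volume), (𝓕⁻ ψ).coeFn_toLp 2, (𝓕 ψ').coeFn_toLp 2]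
      with ξ e1 e2 e3
    rw [e1, Pi.star_apply, e2, e3, SchwartzMap.fourierInv_coe, SchwartzMap.fourier_coe,
      Real.fourierInv_eq', Real.fourier_eq', Complex.star_def, ← integral_conj]
    congr 1 with x
    rw [smul_eq_mul, smul_eq_mul, map_mul, h1, ← Complex.exp_conj]
    congr 2
    simp [Complex.conj_ofNat]

theorem star_mem_holderSubmodule_line {σ : ℝ} (hσ₀ : 0 ≤ σ) (hσ : σ ≤ 1) (ψ : 𝓢(ℝ, ℂ)) :
    ∃ D, ∀ z, ‖Lp.compMeasurePreserving _ (measurePreserving_translate z)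
      (star ((ψ.memLp 2 volume).toLp ψ)) - star ((ψ.memLp 2 volume).toLp ψ)‖ ≤ D * |z| ^ σ := by
  set w : Lp ℂ 2 (volume : Measure ℝ) :=
    Lp.fourierTransformₗᵢ ℝ ℂ (star (ψ.toLp 2 volume)) with hw
  have h1 : w = star ((𝓕⁻ ψ).toLp 2 volume) := by
    rw [← SchwartzMap.toLp_fourierInv_eq, star_fourierInv]
    rfl
  have h2 : MemLp (fun ξ => (lineFreq ξ : ℂ) * w ξ) 2 volume := by
    have hg : Function.HasTemperateGrowth (fun x : ℝ => (x : ℂ)) :=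
      Complex.ofRealCLM.hasTemperateGrowth
    have h3 := (((SchwartzMap.smulLeftCLM ℂ (fun x : ℝ => (x : ℂ)) (𝓕⁻ ψ)).memLp 2
      volume).const_mul (2 * Real.pi : ℂ)).star
    refine h3.ae_eq ?_
    rw [h1]
    filter_upwards [Lp.coeFn_star ((𝓕⁻ ψ).toLp 2 volume), (𝓕⁻ ψ).coeFn_toLp 2] with ξ e1 e2
    rw [e1, Pi.star_apply, Pi.star_apply, e2, SchwartzMap.smulLeftCLM_apply_apply hg, lineFreq]
    simp
    ring
  obtain ⟨D, hD⟩ := mem_holderSubmodule_of_memLp_mul measurable_lineFreq hσ₀ hσ h2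
  refine ⟨D, fun z => ?_⟩
  rw [← (Lp.fourierTransformₗᵢ ℝ ℂ).norm_map, map_sub, fourier_compMeasurePreserving]
  exact hD z

/-- The commutator estimate on the line, for symbols at bounded distance from the square root of the
symbol of a short range kernel. -/
theorem exists_isCommutator {α a c : ℝ} {k : ℝ → ℝ} (hk : IsShortRange α a c k)
    (ha : 0 ≤ a) (hα₀ : 0 < α) (hα₂ : α < 2) {σ K : ℝ} (hK : 0 ≤ K) (hc : 0 ≤ c) (hσ₀ : 0 ≤ σ)
    (hσ₁ : σ ≤ 1) (hσα : σ < α)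
    (hασ : α < 2 * σ) {m : ℝ → ℝ} (hm : Measurable m) {b : ℝ} (hb : 0 ≤ b)
    (hmb : ∀ ζ, |m ζ - √(jumpSymbol k ζ)| ≤ b) {g : ℝ → ℂ} (hg : Measurable g)
    (hgK : ∀ x, ‖g x‖ ≤ K) (hgσ : ∀ x z, ‖g (x + z) - g x‖ ≤ K * |z| ^ σ) {f : ℝ → ℂ}
    (hf : MemLp f 2 volume) :
    ∃ h : ℝ → ℂ, MemLp h 2 volume ∧ IsCommutator m g f h ∧
      (eLpNorm h 2 volume).toReal ≤
        (commConst α σ c + 2 * b) * K * (eLpNorm f 2 volume).toReal := by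
  obtain ⟨h, hn, hh⟩ := exists_commutator hk measurable_lineFreq ha hα₀ hα₂ hK hc hσα hασ
    (m := fun ξ => m (lineFreq ξ)) (hm.comp measurable_lineFreq) hb (fun ξ => hmb _)
    (Lp.fourierTransformₗᵢ ℝ ℂ).toLinearIsometry
    (τ := fun z f => Lp.compMeasurePreserving _ (measurePreserving_translate z) f)
    fourier_compMeasurePreserving (G := mulLp volume hg hgK) (norm_mulLp_apply_le hg hgK)
    (fun z f => norm_comp_mulLp_sub_le _ hg hgK (fun x => hgσ x z) f) (hf.toLp f)
  refine ⟨h, Lp.memLp h, fun ψ => ?_, ?_⟩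
  · have hgf := memLp_bdd_mul hg hgK hf
    have hψ := ψ.memLp 2 volume
    have hgψ := memLp_bdd_mul hg hgK hψ
    obtain ⟨i1, i2, e⟩ := hh (star (hψ.toLp ψ)) (star_mem_holderSubmodule_line hσ₀ hσ₁ ψ)
    have hadj : ContinuousLinearMap.adjoint (mulLp volume hg hgK) (star (hψ.toLp ψ)) =
      star (hgψ.toLp _) := adjoint_mulLp_star hg hgK hψ
    rw [hadj] at i2 e
    rw [mulLp_toLp hg hgK hf] at i1 e
    -- the integrands on the Fourier side agree with those of the duality pairings
    have aux : ∀ {x y : ℝ → ℂ} (hx : MemLp x 2 volume) (hy : MemLp y 2 volume),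
        multIntegrand m x y =ᵐ[volume] fun ξ => (m (lineFreq ξ) : ℂ) *
          (starRingEnd ℂ ((Lp.fourierTransformₗᵢ ℝ ℂ) (star (hy.toLp y)) ξ) *
            (Lp.fourierTransformₗᵢ ℝ ℂ) (hx.toLp x) ξ) := by
      intro x y hx hy
      have h1 : Lp.fourierTransformₗᵢ ℝ ℂ (star (hy.toLp y)) = star (𝓕⁻ (hy.toLp y)) :=
        (star_fourierInv _).symm
      rw [h1]
      filter_upwards [Lp.coeFn_star (𝓕⁻ (hy.toLp y) : Lp ℂ 2 (volume : Measure ℝ))] with ξ hξ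
      rw [hξ, Pi.star_apply, Complex.star_def, Complex.conj_conj, multIntegrand, l2Fourier,
        l2FourierInv, dif_pos hx, dif_pos hy, lineFreq]
      change (m (2 * Real.pi * ξ) : ℂ) * (Lp.fourierTransformₗᵢ ℝ ℂ) (hx.toLp x) ξ * _ = _
      ring
    have a1 := aux hgf hψ
    have a2 := aux hf hgψ
    refine ⟨i1.congr a1.symm, i2.congr a2.symm, ?_⟩
    rw [integral_mul_eq_inner_star (Lp.memLp h) hψ, Lp.toLp_coeFn, multPairing, multPairing,
      integral_congr_ae a1, integral_congr_ae a2]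
    exact e
  · rw [Lp.norm_toLp] at hn
    rwa [← Lp.norm_def]

end Line

/-! ### The circle -/

section Circle

open AddCircle

theorem continuous_of_continuous_coe {u : UnitAddCircle → ℂ} (hu : Continuous fun x : ℝ => u x) :
    Continuous u :=
  QuotientAddGroup.isOpenQuotientMap_mk.isQuotientMap.continuous_iff.2 hu

theorem measurePreserving_circle_translate (z : ℝ) :
    MeasurePreserving (fun x : UnitAddCircle => x + (z : UnitAddCircle)) haarAddCircle
      haarAddCircle := measurePreserving_add_right haarAddCircle _

theorem integral_count_eq_tsum {F : ℤ → ℂ} (hF : Integrable F Measure.count) :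
    ∫ n, F n ∂Measure.count = ∑' n, F n := by
  rw [integral_countable hF]
  simp

theorem memLp_fourierCoeff (f : Lp ℂ 2 (haarAddCircle : Measure UnitAddCircle)) :
    MemLp (fun n => fourierCoeff f n) 2 (Measure.count : Measure ℤ) := by
  rw [memLp_two_iff_integrable_sq_norm (measurable_from_top.aestronglyMeasurable),
    integrable_count_iff]
  simpa using (hasSum_sq_fourierCoeff f).summable

theorem norm_sq_eq_integral {X : Type*} [MeasurableSpace X] {μ : Measure X} (f : Lp ℂ 2 μ) :
    ‖f‖ ^ 2 = ∫ x, ‖f x‖ ^ 2 ∂μ := by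
  rw [← inner_self_eq_norm_sq (𝕜 := ℂ), L2.inner_def, ← integral_re (L2.integrable_inner f f)]
  simp only [inner_self_eq_norm_sq]

/-- The Fourier coefficients, as an isometry into `L²` of the integers. -/
def circleFourier :
    Lp ℂ 2 (haarAddCircle : Measure UnitAddCircle) →ₗᵢ[ℂ] Lp ℂ 2 (Measure.count : Measure ℤ) where
  toFun f := (memLp_fourierCoeff f).toLp _
  map_add' f g := by
    ext1
    filter_upwards [(memLp_fourierCoeff (f + g)).coeFn_toLp, (memLp_fourierCoeff f).coeFn_toLp,
      (memLp_fourierCoeff g).coeFn_toLp, Lp.coeFn_add ((memLp_fourierCoeff f).toLp _)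
        ((memLp_fourierCoeff g).toLp _)] with n h1 h2 h3 h4
    rw [h1, h4, Pi.add_apply, h2, h3, ← fourierBasis_repr, ← fourierBasis_repr,
      ← fourierBasis_repr, map_add]
    rfl
  map_smul' c f := by
    ext1
    filter_upwards [(memLp_fourierCoeff (c • f)).coeFn_toLp, (memLp_fourierCoeff f).coeFn_toLp,
      Lp.coeFn_smul c ((memLp_fourierCoeff f).toLp _)] with n h1 h2 h3
    rw [h1, RingHom.id_apply, h3, Pi.smul_apply, h2, ← fourierBasis_repr, ← fourierBasis_repr,
      map_smul]
    rfl
  norm_map' f := by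
    change ‖(memLp_fourierCoeff f).toLp _‖ = ‖f‖
    rw [← sq_eq_sq₀ (norm_nonneg _) (norm_nonneg _), norm_sq_eq_integral f,
      ← tsum_sq_fourierCoeff f, norm_sq_eq_integral]
    have h1 : (fun n => ‖(memLp_fourierCoeff f).toLp _ n‖ ^ 2) =ᵐ[Measure.count]
        fun n => ‖fourierCoeff f n‖ ^ 2 := by
      filter_upwards [(memLp_fourierCoeff f).coeFn_toLp] with n hn
      rw [hn]
    have h2 : Integrable (fun n => ‖fourierCoeff f n‖ ^ 2) (Measure.count : Measure ℤ) :=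
      (memLp_two_iff_integrable_sq_norm measurable_from_top.aestronglyMeasurable).1
        (memLp_fourierCoeff f)
    rw [integral_congr_ae h1, integral_countable h2]
    simp

theorem circleFourier_apply (f : Lp ℂ 2 (haarAddCircle : Measure UnitAddCircle)) (n : ℤ) :
    circleFourier f n = fourierCoeff f n :=
  Measure.ae_count_iff.1 (memLp_fourierCoeff f).coeFn_toLp n

/-- The frequency `ζ = 2πn` of the character `fourier n`. -/
def circleFreq (n : ℤ) : ℝ := 2 * Real.pi * n

theorem measurable_circleFreq : Measurable circleFreq := measurable_from_top

theorem circleFourier_compMeasurePreserving (z : ℝ)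
    (f : Lp ℂ 2 (haarAddCircle : Measure UnitAddCircle)) :
    circleFourier (Lp.compMeasurePreserving _ (measurePreserving_circle_translate z) f) =
      phase Measure.count measurable_circleFreq z (circleFourier f) := by
  ext1
  filter_upwards [coeFn_phase measurable_circleFreq z (circleFourier f)] with n hn
  rw [hn, circleFourier_apply, circleFourier_apply, fourierCoeff_congr_ae
    (Lp.coeFn_compMeasurePreserving f (measurePreserving_circle_translate z)), fourierCoeff,
    fourierCoeff, ← integral_const_mul]
  rw [← integral_add_right_eq_self (fun t : UnitAddCircle => Complex.exp ((circleFreq n * z : ℝ) *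
    Complex.I) * fourier (-n) t • f t) (z : UnitAddCircle)]
  congr 1 with t
  have h1 : fourier (-n) (t + (z : UnitAddCircle)) =
      fourier (-n) t * fourier (-n) (z : UnitAddCircle) := by
    simp only [fourier_apply, smul_add, toCircle_add, Circle.coe_mul]
  have h2 : Complex.exp ((circleFreq n * z : ℝ) * Complex.I) * fourier (-n) (z : UnitAddCircle) =
      1 := by
    rw [fourier_coe_apply, ← Complex.exp_add, Complex.exp_eq_one_iff]
    refine ⟨0, ?_⟩
    rw [circleFreq]
    push_cast
    ring
  rw [h1, smul_eq_mul, smul_eq_mul, Function.comp_apply]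
  linear_combination (-(fourier (-n) t : ℂ) * f (t + (z : UnitAddCircle))) * h2

theorem star_circleFourier_star {u : UnitAddCircle → ℂ} (hu : MemLp u 2 haarAddCircle) (n : ℤ) :
    starRingEnd ℂ (circleFourier (star (hu.toLp u)) n) = fourierCoeff u (-n) := by
  rw [circleFourier_apply, fourierCoeff, fourierCoeff, ← integral_conj]
  refine integral_congr_ae ?_
  filter_upwards [Lp.coeFn_star (hu.toLp u), hu.coeFn_toLp] with x h1 h2
  rw [h1, Pi.star_apply, h2, smul_eq_mul, smul_eq_mul, map_mul, Complex.star_def,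
    Complex.conj_conj, ← fourier_neg]

theorem exists_lipschitz_of_contDiff {ψ : UnitAddCircle → ℂ}
    (hψ : ContDiff ℝ ∞ fun x : ℝ => ψ x) :
    ∃ L B, 0 ≤ L ∧ 0 ≤ B ∧ (∀ x, ‖ψ x‖ ≤ B) ∧
      ∀ x (z : ℝ), ‖ψ (x + (z : UnitAddCircle)) - ψ x‖ ≤ L * |z| := by
  obtain ⟨B, hB⟩ := isCompact_univ.exists_bound_of_continuousOn
    (continuous_of_continuous_coe hψ.continuous).continuousOn
  have hper : Function.Periodic (deriv fun x : ℝ => ψ x) 1 := by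
    intro x
    rw [← deriv_comp_add_const]
    congr 1
    ext y
    rw [AddCircle.coe_add, AddCircle.coe_period, add_zero]
  have hcont : Continuous (deriv fun x : ℝ => ψ x) := hψ.continuous_deriv (by simp)
  obtain ⟨L, hL⟩ := (isCompact_Icc (a := (0 : ℝ)) (b := 1)).exists_bound_of_continuousOn
    hcont.continuousOn
  have hL' : ∀ x, ‖deriv (fun x : ℝ => ψ x) x‖ ≤ L := fun x => by
    obtain ⟨y, hy, hxy⟩ := hper.exists_mem_Ico₀ one_pos x
    rw [hxy]
    exact hL y ⟨hy.1, hy.2.le⟩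
  refine ⟨L, B, (norm_nonneg _).trans (hL' 0), (norm_nonneg _).trans (hB 0 (mem_univ _)),
    fun x => hB x (mem_univ x), fun x z => ?_⟩
  obtain ⟨x, rfl⟩ := QuotientAddGroup.mk_surjective x
  have h1 := convex_univ.norm_image_sub_le_of_norm_deriv_le (f := fun x : ℝ => ψ x) (C := L)
    (x := x) (y := x + z) (fun y _ => (hψ.differentiable (by simp)).differentiableAt)
    (fun y _ => hL' y) (mem_univ _) (mem_univ _)
  rw [add_sub_cancel_left, Real.norm_eq_abs] at h1
  exact h1

theorem star_mem_holderSubmodule_circle {σ : ℝ} (hσ₀ : 0 ≤ σ) (hσ : σ ≤ 1)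
    {ψ : UnitAddCircle → ℂ} (hψ : ContDiff ℝ ∞ fun x : ℝ => ψ x)
    (hψL : MemLp ψ 2 haarAddCircle) :
    ∃ D, ∀ z, ‖Lp.compMeasurePreserving _ (measurePreserving_circle_translate z)
      (star (hψL.toLp ψ)) - star (hψL.toLp ψ)‖ ≤ D * |z| ^ σ := by
  obtain ⟨L, B, hL, hB, hBψ, hLψ⟩ := exists_lipschitz_of_contDiff hψ
  refine ⟨L + 2 * B, fun z => ?_⟩
  have key : ∀ M, 0 ≤ M → (∀ x, ‖ψ (x + (z : UnitAddCircle)) - ψ x‖ ≤ M) →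
      ‖Lp.compMeasurePreserving _ (measurePreserving_circle_translate z)
      (star (hψL.toLp ψ)) - star (hψL.toLp ψ)‖ ≤ M := by
    intro M hM0 hM
    have h1 : ∀ᵐ x ∂haarAddCircle, star (hψL.toLp ψ) x = star (ψ x) := by
      filter_upwards [Lp.coeFn_star (hψL.toLp ψ), hψL.coeFn_toLp] with x e1 e2
      rw [e1, Pi.star_apply, e2]
    refine (Lp.norm_le_of_ae_bound hM0 ?_).trans_eq (b := _ * M) (by simp [measureUnivNNReal])
    filter_upwards [Lp.coeFn_sub (Lp.compMeasurePreserving _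
        (measurePreserving_circle_translate z) (star (hψL.toLp ψ))) (star (hψL.toLp ψ)),
      Lp.coeFn_compMeasurePreserving (star (hψL.toLp ψ)) (measurePreserving_circle_translate z),
      h1, (measurePreserving_circle_translate z).quasiMeasurePreserving.ae h1] with x e1 e2 e3 e4
    rw [e1, Pi.sub_apply, e2, Function.comp_apply, e4, e3, ← star_sub, norm_star]
    exact hM x
  refine le_mul_rpow_abs_of_le hσ₀ hσ hL (by positivity) ?_ ?_
  · exact key _ (by positivity) fun x => hLψ x z
  · refine key _ (by positivity) fun x => (norm_sub_le _ _).trans ?_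
    linarith [hBψ x, hBψ (x + (z : UnitAddCircle))]

/-- The commutator estimate on the circle, for symbols at bounded distance from the square root of
the symbol of a short range kernel. -/
theorem exists_isCommutatorCircle {α a c : ℝ} {k : ℝ → ℝ} (hk : IsShortRange α a c k)
    (ha : 0 ≤ a) (hα₀ : 0 < α) (hα₂ : α < 2) {σ K : ℝ} (hK : 0 ≤ K) (hc : 0 ≤ c) (hσ₀ : 0 ≤ σ)
    (hσ₁ : σ ≤ 1) (hσα : σ < α)
    (hασ : α < 2 * σ) {m : ℝ → ℝ} (hm : Measurable m) {b : ℝ} (hb : 0 ≤ b)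
    (hmb : ∀ ζ, |m ζ - √(jumpSymbol k ζ)| ≤ b) {g : UnitAddCircle → ℂ} (hg : Measurable g)
    (hgK : ∀ x, ‖g x‖ ≤ K)
    (hgσ : ∀ x (z : ℝ), ‖g (x + (z : UnitAddCircle)) - g x‖ ≤ K * |z| ^ σ)
    {f : UnitAddCircle → ℂ} (hf : MemLp f 2 haarAddCircle) :
    ∃ h : UnitAddCircle → ℂ, MemLp h 2 haarAddCircle ∧ IsCommutatorCircle m g f h ∧
      (eLpNorm h 2 haarAddCircle).toReal ≤
        (commConst α σ c + 2 * b) * K * (eLpNorm f 2 haarAddCircle).toReal := by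
  obtain ⟨h, hn, hh⟩ := exists_commutator hk measurable_circleFreq ha hα₀ hα₂ hK hc hσα hασ
    (m := fun n => m (circleFreq n)) (hm.comp measurable_circleFreq) hb (fun n => hmb _)
    circleFourier
    (τ := fun z f => Lp.compMeasurePreserving _ (measurePreserving_circle_translate z) f)
    circleFourier_compMeasurePreserving (G := mulLp haarAddCircle hg hgK)
    (norm_mulLp_apply_le hg hgK)
    (fun z f => norm_comp_mulLp_sub_le _ hg hgK (fun x => hgσ x z) f) (hf.toLp f)
  refine ⟨h, Lp.memLp h, fun ψ hψ => ?_, ?_⟩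
  · have hgf := memLp_bdd_mul hg hgK hf
    obtain ⟨L, B, hL, hB, hBψ, hLψ⟩ := exists_lipschitz_of_contDiff hψ
    have hψL : MemLp ψ 2 haarAddCircle := MemLp.of_bound
      (continuous_of_continuous_coe hψ.continuous).aestronglyMeasurable B (ae_of_all _ hBψ)
    have hgψ := memLp_bdd_mul hg hgK hψL
    obtain ⟨i1, i2, e⟩ := hh (star (hψL.toLp ψ))
      (star_mem_holderSubmodule_circle hσ₀ hσ₁ hψ hψL)
    have hadj : ContinuousLinearMap.adjoint (mulLp haarAddCircle hg hgK) (star (hψL.toLp ψ)) =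
      star (hgψ.toLp _) := adjoint_mulLp_star hg hgK hψL
    rw [hadj] at i2 e
    rw [mulLp_toLp hg hgK hf] at i1 e
    -- the summands on the Fourier side are those of the duality pairings
    have aux : ∀ {x y : UnitAddCircle → ℂ} (hx : MemLp x 2 haarAddCircle)
        (hy : MemLp y 2 haarAddCircle),
        (fun n => (m (circleFreq n) : ℂ) * (starRingEnd ℂ (circleFourier (star (hy.toLp y)) n) *
          circleFourier (hx.toLp x) n)) = multSummand m x y := by
      intro x y hx hy
      ext n
      rw [star_circleFourier_star, circleFourier_apply, fourierCoeff_congr_ae hx.coeFn_toLp,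
        multSummand, circleFreq]
      ring
    rw [aux hgf hψL] at i1 e
    rw [aux hf hgψ] at i2 e
    rw [integral_count_eq_tsum i1, integral_count_eq_tsum i2] at e
    refine ⟨(integrable_count_iff.1 i1).of_norm, (integrable_count_iff.1 i2).of_norm, ?_⟩
    rw [integral_mul_eq_inner_star (Lp.memLp h) hψL, Lp.toLp_coeFn]
    exact e
  · rw [Lp.norm_toLp] at hn
    rwa [← Lp.norm_def]

end Circle

/-! ### Hölder spaces -/

section Holder

/-- The only information on `g ∈ C^s` that the commutator estimate uses: `g` is bounded, and Hölder
continuous of every exponent `σ ≤ min s 1`. -/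
theorem MemHolder.bounds {s σ : ℝ} (hσ₀ : 0 < σ) (hσs : σ ≤ s) (hσ₁ : σ ≤ 1) {g : ℝ → ℂ}
    (hg : MemHolder s g) :
    (∀ x, ‖g x‖ ≤ (holderNorm s g).toReal) ∧
      ∀ x z, ‖g (x + z) - g x‖ ≤ 3 * (holderNorm s g).toReal * |z| ^ σ := by
  obtain ⟨hd, hfin⟩ := hg
  set N := (holderNorm s g).toReal with hN
  have hN0 : 0 ≤ N := ENNReal.toReal_nonneg
  have hj : ∀ j ≤ ⌊s⌋₊, ∀ x, ‖iteratedDeriv j g x‖ ≤ N := by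
    intro j hj x
    rw [← toReal_enorm]
    refine ENNReal.toReal_mono hfin.ne ?_
    refine (le_iSup (fun x => ‖iteratedDeriv j g x‖ₑ) x).trans (le_trans ?_ le_self_add)
    exact Finset.single_le_sum (f := fun j => ⨆ x, ‖iteratedDeriv j g x‖ₑ)
      (fun _ _ => zero_le) (Finset.mem_range.2 (Nat.lt_succ_of_le hj))
  have h0 : ∀ x, ‖g x‖ ≤ N := fun x => by simpa using hj 0 (Nat.zero_le _) x
  have h2 : ∀ x z, ‖g (x + z) - g x‖ ≤ 2 * N := fun x z =>
    (norm_sub_le _ _).trans (by linarith [h0 (x + z), h0 x])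
  refine ⟨h0, fun x z => ?_⟩
  -- below order one the seminorm is that of `g` itself; otherwise `g` has a bounded derivative
  rcases Nat.eq_zero_or_pos ⌊s⌋₊ with hk | hk
  · have h3 : eHolderNorm s.toNNReal g ≤ holderNorm s g := by
      refine le_trans (le_of_eq ?_) le_add_self
      rw [hk, Nat.cast_zero, sub_zero, iteratedDeriv_zero]
    have h4 : _root_.MemHolder s.toNNReal g := eHolderNorm_lt_top.1 (h3.trans_lt hfin)
    have h5 := h4.holderWith.dist_le (x + z) x
    have h6 : (nnHolderNorm s.toNNReal g : ℝ) ≤ N := ENNReal.toReal_mono hfin.ne h3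
    rw [dist_eq_norm, Real.dist_eq, add_sub_cancel_left, Real.coe_toNNReal s (by linarith)] at h5
    rcases le_total |z| 1 with hz | hz
    · have h7 : |z| ^ s ≤ |z| ^ σ :=
        Real.rpow_le_rpow_of_exponent_ge_of_imp (abs_nonneg z) hz hσs fun _ h => by linarith
      calc _ ≤ N * |z| ^ σ := h5.trans (mul_le_mul h6 h7 (by positivity) hN0)
        _ ≤ _ := by
          have : 0 ≤ N * |z| ^ σ := by positivity
          linarith
    · have h7 : 1 ≤ |z| ^ σ := Real.one_le_rpow hz hσ₀.le
      have h8 := mul_le_mul_of_nonneg_left h7 (by positivity : 0 ≤ 3 * N)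
      linarith [h2 x z]
  · have hd1 : Differentiable ℝ g :=
      hd.differentiable (by exact_mod_cast (Nat.pos_iff_ne_zero.1 hk))
    have h3 := convex_univ.norm_image_sub_le_of_norm_deriv_le (f := g) (C := N) (x := x)
      (y := x + z) (fun y _ => hd1.differentiableAt)
      (fun y _ => by simpa using hj 1 hk y) (mem_univ _) (mem_univ _)
    rw [add_sub_cancel_left, Real.norm_eq_abs] at h3
    refine (le_mul_rpow_abs_of_le hσ₀.le hσ₁ hN0 (by positivity) h3 (h2 x z)).trans_eq ?_
    ring

end Holder

/-! ### Lévy kernels -/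

section LevyKernel

theorem abs_sqrt_sub_sqrt_le {x y B : ℝ} (hxy : |x - y| ≤ B) : |√x - √y| ≤ √B := by
  have hB : 0 ≤ B := (abs_nonneg _).trans hxy
  have aux : ∀ {x y : ℝ}, |x - y| ≤ B → √x ≤ √y + √B := by
    intro x y h
    refine Real.sqrt_le_iff.2 ⟨by positivity, ?_⟩
    have h1 := (abs_le.1 h).2
    have h2 := Real.sq_sqrt hB
    have h3 : y ≤ √y ^ 2 := by
      rcases le_total 0 y with hy | hy
      · rw [Real.sq_sqrt hy]
      · exact hy.trans (by positivity)
    have h4 : 0 ≤ √y * √B := by positivity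
    nlinarith
  have h1 := aux hxy
  have h2 := aux (abs_sub_comm x y ▸ hxy)
  rw [abs_le]
  constructor <;> linarith

variable {α a₀ c₁ c₂ : ℝ} {φ : ℝ → ℝ}

/-- The part of a kernel with jumps smaller than `a₀`. The value at the origin, of which nothing is
known, is replaced by `0`. -/
def shortPart (a₀ : ℝ) (φ : ℝ → ℝ) : ℝ → ℝ := {x : ℝ | 0 < |x| ∧ |x| < a₀}.indicator φ

theorem measurableSet_short (a₀ : ℝ) : MeasurableSet {x : ℝ | 0 < |x| ∧ |x| < a₀} := by
  have h1 : MeasurableSet {x : ℝ | 0 < |x|} := measurableSet_lt (by fun_prop) (by fun_prop)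
  have h2 : MeasurableSet {x : ℝ | |x| < a₀} := measurableSet_lt (by fun_prop) (by fun_prop)
  exact h1.inter h2

theorem measurableSet_long (a₀ : ℝ) : MeasurableSet {x : ℝ | a₀ ≤ |x|} :=
  measurableSet_le (by fun_prop) (by fun_prop)

theorem shortPart_eq (φ : ℝ → ℝ) (a₀ : ℝ) :
    shortPart a₀ φ = {x : ℝ | 0 < |x| ∧ |x| < a₀}.indicator (({0}ᶜ : Set ℝ).indicator φ) := by
  rw [indicator_indicator, shortPart]
  congr 1
  ext x
  simp +contextual

namespace IsLevyKernel

theorem measurable_indicator (h : IsLevyKernel α a₀ c₁ c₂ φ) :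
    Measurable (({0}ᶜ : Set ℝ).indicator φ) := by
  classical
  rw [← piecewise_eq_indicator]
  exact h.smooth.continuousOn.measurable_piecewise continuousOn_const
    (measurableSet_singleton 0).compl

theorem isShortRange (h : IsLevyKernel α a₀ c₁ c₂ φ) (hc₁ : 1 ≤ c₁) :
    IsShortRange α a₀ c₁ (shortPart a₀ φ) := by
  refine ⟨?_, fun z => ?_, fun z => ?_, fun z hz => ?_, fun z hz => ?_⟩
  · rw [shortPart_eq]
    exact h.measurable_indicator.indicator (measurableSet_short a₀)
  · refine indicator_nonneg (fun x hx => ?_) z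
    refine le_trans ?_ (h.lower x hx.1 hx.2.le)
    positivity
  · simp [shortPart, indicator, h.even]
  · by_cases hS : z ∈ {x : ℝ | 0 < |x| ∧ |x| < a₀}
    · rw [shortPart, indicator_of_mem hS]
      refine (h.upper z hS.1 hS.2.le).trans_eq ?_
      rw [div_eq_mul_inv, ← Real.rpow_neg (abs_nonneg z)]
      congr 2
      ring
    · rw [shortPart, indicator_of_notMem hS]
      positivity
  · exact indicator_of_notMem (fun hS => (hS.2.trans hz).false) _

/-- The long jumps, which carry no sign condition, contribute a bounded function to the symbol. -/
theorem abs_levySymbol_sub_le (h : IsLevyKernel α a₀ c₁ c₂ φ) (hα₂ : α < 2) (ha₀ : 0 < a₀)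
    (hc₁ : 1 ≤ c₁) (ζ : ℝ) :
    |levySymbol φ ζ - jumpSymbol (shortPart a₀ φ) ζ| ≤ 2 * c₂ := by
  set F : ℝ → ℝ := fun x => (1 - Real.cos (ζ * x)) * φ x with hF
  have hsplit : ({0}ᶜ : Set ℝ) = {x : ℝ | 0 < |x| ∧ |x| < a₀} ∪ {x : ℝ | a₀ ≤ |x|} := by
    ext x
    simp only [mem_compl_iff, mem_singleton_iff, mem_union, mem_ofPred_eq, abs_pos]
    constructor
    · intro hx
      rcases lt_or_ge |x| a₀ with h1 | h1
      · exact Or.inl ⟨hx, h1⟩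
      · exact Or.inr h1
    · rintro (hx | hx)
      · exact hx.1
      · exact abs_pos.1 (ha₀.trans_le hx)
  have hdisj : Disjoint {x : ℝ | 0 < |x| ∧ |x| < a₀} {x : ℝ | a₀ ≤ |x|} :=
    disjoint_left.2 fun x hx hx' => (hx.2.trans_le hx').false
  have hφm : AEStronglyMeasurable φ (volume.restrict {x : ℝ | a₀ ≤ |x|}) := by
    refine h.measurable_indicator.aestronglyMeasurable.congr ?_
    filter_upwards [ae_restrict_mem (measurableSet_long a₀)] with x hx
    rw [indicator_of_mem]
    exact abs_pos.1 (ha₀.trans_le hx)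
  have hφabs : IntegrableOn (fun x => |φ x|) {x : ℝ | a₀ ≤ |x|} := by
    simpa using h.tail_integrable 0 (by norm_num)
  have hφle : ∫ x in {x : ℝ | a₀ ≤ |x|}, |φ x| ≤ c₂ := by
    simpa using h.tail_le 0 (by norm_num)
  have hFbound : ∀ x, ‖F x‖ ≤ 2 * |φ x| := fun x => by
    rw [hF, norm_mul, Real.norm_of_nonneg (one_sub_cos_mem _).1]
    exact mul_le_mul_of_nonneg_right (one_sub_cos_mem _).2 (abs_nonneg _)
  have hFlong : IntegrableOn F {x : ℝ | a₀ ≤ |x|} := by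
    refine (hφabs.const_mul 2).mono' ?_ (ae_of_all _ hFbound)
    exact (Continuous.aestronglyMeasurable (by fun_prop)).mul hφm
  have hshort : (fun x => (1 - Real.cos (ζ * x)) * shortPart a₀ φ x) =
      {x : ℝ | 0 < |x| ∧ |x| < a₀}.indicator F := by
    ext x
    rw [shortPart, hF]
    exact (indicator_mul_right _ (fun x => 1 - Real.cos (ζ * x)) φ).symm
  have hFshort : IntegrableOn F {x : ℝ | 0 < |x| ∧ |x| < a₀} := by
    rw [← integrable_indicator_iff (measurableSet_short a₀), ← hshort]
    exact (h.isShortRange hc₁).integrable_symbol ha₀.le hα₂ ζ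
  have h1 : levySymbol φ ζ - jumpSymbol (shortPart a₀ φ) ζ = ∫ x in {x : ℝ | a₀ ≤ |x|}, F x := by
    rw [levySymbol, jumpSymbol, hsplit, setIntegral_union hdisj (measurableSet_long a₀) hFshort
      hFlong, hshort, integral_indicator (measurableSet_short a₀), add_sub_cancel_left]
  rw [h1, ← Real.norm_eq_abs]
  refine (norm_integral_le_of_norm_le (hφabs.const_mul 2) (ae_of_all _ hFbound)).trans ?_
  rw [integral_const_mul]
  linarith

theorem measurable_sqrtSymbol (h : IsLevyKernel α a₀ c₁ c₂ φ) (C' : ℝ) :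
    Measurable (sqrtSymbol φ C') := by
  have h1 : levySymbol φ = jumpSymbol (({0}ᶜ : Set ℝ).indicator φ) := by
    ext ζ
    rw [levySymbol, jumpSymbol, ← integral_indicator (measurableSet_singleton 0).compl]
    congr 1 with x
    exact indicator_mul_right _ (fun x => 1 - Real.cos (ζ * x)) φ
  have h2 : Measurable (levySymbol φ) := h1 ▸ measurable_jumpSymbol h.measurable_indicator
  exact (h2.const_add C').sqrt

/-- The square root is Hölder continuous of exponent `1/2` on the whole line (it vanishes on the
negative half-line), so the long jumps and `C'` change the symbol by a bounded function only. -/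
theorem abs_sqrtSymbol_sub_le (h : IsLevyKernel α a₀ c₁ c₂ φ) (hα₂ : α < 2) (ha₀ : 0 < a₀)
    (hc₁ : 1 ≤ c₁) (C' ζ : ℝ) :
    |sqrtSymbol φ C' ζ - √(jumpSymbol (shortPart a₀ φ) ζ)| ≤ √(|C'| + 2 * c₂) := by
  refine abs_sqrt_sub_sqrt_le ?_
  rw [add_sub_assoc]
  exact (abs_add_le _ _).trans (add_le_add le_rfl (h.abs_levySymbol_sub_le hα₂ ha₀ hc₁ ζ))

/-- Coercivity of the symbol of the short range part: jumps of size comparable to `1 / |ζ|`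
suffice. -/
theorem le_jumpSymbol_shortPart (h : IsLevyKernel α a₀ c₁ c₂ φ) (hα₀ : 0 < α) (hα₂ : α < 2)
    (ha₀ : 0 < a₀) (hc₁ : 1 ≤ c₁) {ζ : ℝ} (hζ : 1 / a₀ ≤ |ζ|) :
    1 / (4 * Real.pi ^ 2 * c₁) * |ζ| ^ α ≤ jumpSymbol (shortPart a₀ φ) ζ := by
  set y := |ζ| with hy
  have hy0 : 0 < y := lt_of_lt_of_le (by positivity) hζ
  have hya : 1 / y ≤ a₀ := by
    rw [div_le_iff₀ hy0]
    rwa [div_le_iff₀ ha₀, mul_comm] at hζ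
  have hc0 : 0 < c₁ := one_pos.trans_le hc₁
  -- the lower bound of the integrand for `1 / (2 |ζ|) < x < 1 / |ζ|`
  set B := 1 / (2 * Real.pi ^ 2 * c₁) * y ^ (1 + α) with hB
  have hk := h.isShortRange hc₁
  have hle : ∀ x, (Ioo (1 / (2 * y)) (1 / y)).indicator (fun _ => B) x ≤
      (1 - Real.cos (ζ * x)) * shortPart a₀ φ x := by
    refine indicator_le' (fun x hx => ?_) fun x _ => mul_nonneg (one_sub_cos_mem _).1 (hk.nonneg x)
    have hx0 : 0 < x := lt_trans (by positivity) hx.1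
    have hxabs : |x| = x := abs_of_pos hx0
    have hxa : x < a₀ := hx.2.trans_le hya
    have hyx : y * x ≤ 1 := by
      have := hx.2.le
      rw [le_div_iff₀ hy0] at this
      linarith
    have hyx' : 1 / 2 ≤ y * x := by
      have := hx.1.le
      rw [div_le_iff₀ (by positivity)] at this
      linarith
    have habs : |ζ * x| = y * x := by rw [abs_mul, hxabs]
    have hcos : 1 / (2 * Real.pi ^ 2) ≤ 1 - Real.cos (ζ * x) := by
      have h2 := Real.cos_le_one_sub_mul_cos_sq (x := ζ * x)
        (by rw [habs]; linarith [Real.pi_gt_three])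
      have h3 : (1 / 2) ^ 2 ≤ (ζ * x) ^ 2 := by
        rw [← sq_abs (ζ * x), habs]
        exact pow_le_pow_left₀ (by norm_num) hyx' 2
      have h4 : 2 / Real.pi ^ 2 * (1 / 2) ^ 2 ≤ 2 / Real.pi ^ 2 * (ζ * x) ^ 2 :=
        mul_le_mul_of_nonneg_left h3 (by positivity)
      have h5 : 1 / (2 * Real.pi ^ 2) = 2 / Real.pi ^ 2 * (1 / 2) ^ 2 := by
        field_simp
      linarith
    have hφ : 1 / c₁ * y ^ (1 + α) ≤ φ x := by
      refine le_trans (mul_le_mul_of_nonneg_left ?_ (by positivity))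
        (h.lower x (by rwa [hxabs]) (by rw [hxabs]; exact hxa.le))
      rw [hxabs, le_div_iff₀ (by positivity), ← Real.mul_rpow hy0.le hx0.le]
      exact Real.rpow_le_one (by positivity) hyx (by linarith)
    rw [shortPart, indicator_of_mem (by exact ⟨by rwa [hxabs], by rwa [hxabs]⟩), hB]
    calc _ = 1 / (2 * Real.pi ^ 2) * (1 / c₁ * y ^ (1 + α)) := by field_simp
      _ ≤ _ := mul_le_mul hcos hφ (by positivity) (one_sub_cos_mem _).1
  have h1 : ∫ x, (Ioo (1 / (2 * y)) (1 / y)).indicator (fun _ => B) x = 1 / (2 * y) * B := by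
    rw [integral_indicator measurableSet_Ioo, setIntegral_const, smul_eq_mul,
      Real.volume_real_Ioo_of_le]
    · congr 1
      field_simp
      norm_num
    · gcongr
      linarith
  have h2 : ∫ x, (Ioo (1 / (2 * y)) (1 / y)).indicator (fun _ => B) x ≤
      jumpSymbol (shortPart a₀ φ) ζ := by
    refine integral_mono ?_ (hk.integrable_symbol ha₀.le hα₂ ζ) hle
    exact (integrable_indicator_iff measurableSet_Ioo).2
      (integrableOn_const (by simp))
  refine le_trans (le_of_eq ?_) h2
  rw [h1, hB, Real.rpow_add hy0, Real.rpow_one]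
  field_simp
  norm_num

end IsLevyKernel

/-- Coercivity of the symbol, with a constant that depends on the parameters of `φ` only. -/
theorem exists_symbol_lower_bound (hα₀ : 0 < α) (hα₂ : α < 2) (ha₀ : 0 < a₀) (hc₁ : 1 ≤ c₁) :
    ∃ C' : ℝ, 0 < C' ∧ ∀ φ : ℝ → ℝ, IsLevyKernel α a₀ c₁ c₂ φ →
      ∀ ζ : ℝ, C'⁻¹ * |ζ| ^ α - C' / 2 ≤ levySymbol φ ζ := by
  have hc0 : 0 < c₁ := one_pos.trans_le hc₁
  set q := 1 / (4 * Real.pi ^ 2 * c₁) with hq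
  have hq0 : 0 < q := by positivity
  set D := q * (1 / a₀) ^ α + 2 * c₂ with hD
  -- `C' ≥ q⁻¹` takes care of the leading term, `C' ≥ 2 D` of the constant one
  set C' := max q⁻¹ (2 * D) with hC'
  have hC0 : 0 < C' := lt_max_of_lt_left (by positivity)
  refine ⟨C', hC0, fun φ h ζ => ?_⟩
  have h1 : C'⁻¹ ≤ q := inv_le_of_inv_le₀ hq0 (le_max_left _ _)
  have h2 : 2 * D ≤ C' := le_max_right _ _
  have h3 := (abs_le.1 (h.abs_levySymbol_sub_le hα₂ ha₀ hc₁ ζ)).1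
  have h4 : q * |ζ| ^ α ≤ jumpSymbol (shortPart a₀ φ) ζ + q * (1 / a₀) ^ α := by
    rcases le_total (1 / a₀) |ζ| with hζ | hζ
    · have := h.le_jumpSymbol_shortPart hα₀ hα₂ ha₀ hc₁ hζ
      have h5 : 0 ≤ q * (1 / a₀) ^ α := by positivity
      linarith
    · have := jumpSymbol_nonneg (h.isShortRange hc₁).nonneg ζ
      have h5 : |ζ| ^ α ≤ (1 / a₀) ^ α := Real.rpow_le_rpow (abs_nonneg _) hζ hα₀.le
      have := mul_le_mul_of_nonneg_left h5 hq0.le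
      linarith
  have h6 : C'⁻¹ * |ζ| ^ α ≤ q * |ζ| ^ α := mul_le_mul_of_nonneg_right h1 (by positivity)
  linarith

end LevyKernel

/-- The estimate between real norms, with `3 N` as the Hölder constant, as one between norms in
`[0, ∞]`. -/
theorem le_ofReal_mul_of_toReal_le {x y N : ℝ≥0∞} (hx : x ≠ ⊤) (hy : y ≠ ⊤) (hN : N ≠ ⊤) {B C : ℝ}
    (hC₀ : 0 ≤ C) (hBC : 3 * B ≤ C) (h : x.toReal ≤ B * (3 * N.toReal) * y.toReal) :
    x ≤ ENNReal.ofReal C * y * N := by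
  rw [← ENNReal.toReal_le_toReal hx (by finiteness), ENNReal.toReal_mul, ENNReal.toReal_mul,
    ENNReal.toReal_ofReal hC₀]
  have h1 : 0 ≤ N.toReal * y.toReal := by positivity
  have h2 := mul_le_mul_of_nonneg_right hBC h1
  linarith

end

end LevyCommutator

theorem lemma6p2 (α a₀ c₁ c₂ : ℝ) (hα₀ : 0 < α) (hα₂ : α < 2) (ha₀ : 0 < a₀) (hc₁ : 1 ≤ c₁)
    (hc₂ : 0 < c₂) :
    -- the constant `C'`, depending only on `α, a₀, c₁, c₂`
    (∃ C' : ℝ, 0 < C' ∧ ∀ φ : ℝ → ℝ, LevyCommutator.IsLevyKernel α a₀ c₁ c₂ φ →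
      ∀ ζ : ℝ, C'⁻¹ * |ζ| ^ α - C' / 2 ≤ LevyCommutator.levySymbol φ ζ) ∧
    -- the commutator estimate, for this and every other `C'` for which `C' + A` is positive
    ∀ φ : ℝ → ℝ, LevyCommutator.IsLevyKernel α a₀ c₁ c₂ φ →
    ∀ C' : ℝ, (∀ ζ : ℝ, 0 < C' + LevyCommutator.levySymbol φ ζ) →
    ∀ ε : ℝ, 0 < ε → ∃ C : ℝ, 0 < C ∧
      (∀ g : ℝ → ℂ, LevyCommutator.MemHolder (α / 2 + ε) g →
        ∀ f : ℝ → ℂ, MemLp f 2 volume →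
        ∃ h : ℝ → ℂ, MemLp h 2 volume ∧
          LevyCommutator.IsCommutator (LevyCommutator.sqrtSymbol φ C') g f h ∧
          eLpNorm h 2 volume ≤
            ENNReal.ofReal C * eLpNorm f 2 volume * LevyCommutator.holderNorm (α / 2 + ε) g) ∧
      (∀ g : UnitAddCircle → ℂ, LevyCommutator.MemHolder (α / 2 + ε) (fun x : ℝ => g x) →
        ∀ f : UnitAddCircle → ℂ, MemLp f 2 AddCircle.haarAddCircle →
        ∃ h : UnitAddCircle → ℂ, MemLp h 2 AddCircle.haarAddCircle ∧
          LevyCommutator.IsCommutatorCircle (LevyCommutator.sqrtSymbol φ C') g f h ∧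
          eLpNorm h 2 AddCircle.haarAddCircle ≤
            ENNReal.ofReal C * eLpNorm f 2 AddCircle.haarAddCircle *
              LevyCommutator.holderNorm (α / 2 + ε) (fun x : ℝ => g x)) := by
  refine ⟨LevyCommutator.exists_symbol_lower_bound hα₀ hα₂ ha₀ hc₁, fun φ hφ C' _ ε hε => ?_⟩
  -- an exponent `σ ≤ α / 2 + ε` with `α / 2 < σ < min α 1`
  obtain ⟨σ, hσs, hασ, hσα, hσ₁⟩ : ∃ σ, σ ≤ α / 2 + ε ∧ α < 2 * σ ∧ σ < α ∧ σ ≤ 1 := by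
    refine ⟨α / 2 + min ε (min (α / 4) ((2 - α) / 4)), ?_, ?_, ?_, ?_⟩
    · linarith [min_le_left ε (min (α / 4) ((2 - α) / 4))]
    · have : 0 < min ε (min (α / 4) ((2 - α) / 4)) :=
        lt_min hε (lt_min (by linarith) (by linarith))
      linarith
    · linarith [(min_le_right ε (min (α / 4) ((2 - α) / 4))).trans (min_le_left _ _)]
    · linarith [(min_le_right ε (min (α / 4) ((2 - α) / 4))).trans (min_le_right _ _)]
  have hσ₀ : 0 < σ := by linarith
  have hc0 : 0 ≤ c₁ := by linarith
  set b := √(|C'| + 2 * c₂) with hb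
  have hcC := LevyCommutator.commConst_nonneg hc0 hσα hασ
  have hk := hφ.isShortRange hc₁
  have hm := hφ.measurable_sqrtSymbol C'
  have hmb := hφ.abs_sqrtSymbol_sub_le hα₂ ha₀ hc₁ C'
  have hb0 : 0 ≤ b := Real.sqrt_nonneg _
  refine ⟨3 * (LevyCommutator.commConst α σ c₁ + 2 * b) + 1, by positivity, fun g hg f hf => ?_,
    fun g hg f hf => ?_⟩
  · obtain ⟨hgN, hgσ⟩ := LevyCommutator.MemHolder.bounds hσ₀ hσs hσ₁ hg
    set N := (LevyCommutator.holderNorm (α / 2 + ε) g).toReal with hN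
    have hN0 : 0 ≤ N := ENNReal.toReal_nonneg
    obtain ⟨h, hh, hcomm, hle⟩ := LevyCommutator.exists_isCommutator hk ha₀.le hα₀ hα₂ (K := 3 * N)
      (by positivity) hc0 hσ₀.le hσ₁ hσα hασ hm hb0 hmb hg.1.continuous.measurable
      (fun x => (hgN x).trans (by linarith)) hgσ hf
    exact ⟨h, hh, hcomm, LevyCommutator.le_ofReal_mul_of_toReal_le hh.eLpNorm_ne_top
      hf.eLpNorm_ne_top hg.2.ne (by positivity) (by linarith) hle⟩
  · obtain ⟨hgN, hgσ⟩ := LevyCommutator.MemHolder.bounds hσ₀ hσs hσ₁ hg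
    set N := (LevyCommutator.holderNorm (α / 2 + ε) fun x : ℝ => g x).toReal with hN
    have hN0 : 0 ≤ N := ENNReal.toReal_nonneg
    have hgN' : ∀ x, ‖g x‖ ≤ 3 * N := fun x => by
      obtain ⟨x, rfl⟩ := QuotientAddGroup.mk_surjective x
      exact (hgN x).trans (by linarith)
    have hgσ' : ∀ x (z : ℝ), ‖g (x + (z : UnitAddCircle)) - g x‖ ≤ 3 * N * |z| ^ σ := fun x z => by
      obtain ⟨x, rfl⟩ := QuotientAddGroup.mk_surjective x
      exact hgσ x z
    obtain ⟨h, hh, hcomm, hle⟩ := LevyCommutator.exists_isCommutatorCircle hk ha₀.le hα₀ hα₂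
      (K := 3 * N) (by positivity) hc0 hσ₀.le hσ₁ hσα hασ hm hb0 hmb
      (LevyCommutator.continuous_of_continuous_coe hg.1.continuous).measurable hgN' hgσ' hf
    exact ⟨h, hh, hcomm, LevyCommutator.le_ofReal_mul_of_toReal_le hh.eLpNorm_ne_top
      hf.eLpNorm_ne_top hg.2.ne (by positivity) (by linarith) hle⟩
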